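/- Let $1<p<q<\infty$ and $1/r=1/p-1/q$. For $k\in\mathbb Z$ put $\Delta_k=(-2^{k+1},-2^k]\cup[2^k,2^{k+1})$. (i) There is a constant $C<\infty$ depending only on $p$ and $q$ such that the following holds. Let $\lambda:\mathbb R\to\mathbb R$ be absolutely continuous on $(-\infty,0]$ and on $[0,\infty)$ (it suffices that it is absolutely continuous on every compact subinterval of each of them), and let $\lambda(\xi)\to0$ as $|\xi|\to\infty$. For a Schwartz function $f$ on $\mathbb R$ let $T_\lambda f=\mathcal F^{-1}(\lambda\,\mathcal Ff)$, where $\mathcal Ff(\xi)=\frac1{\sqrt{2\pi}}\int_{\mathbb R}f(x)e^{-ix\xi}\,dx$, and let $\|T_\lambda\|_{L_p(\mathbb R)\to L_q(\mathbb R)}\in[0,\infty]$ be the least $A$ with $\|T_\lambda f\|_{L_q(\mathbb R)}\le A\|f\|_{L_p(\mathbb R)}$ for all Schwartz functions $f$. Then $$\|T_\lambda\|_{L_p(\mathbb R)\to L_q(\mathbb R)}\le C\,\sup_{k\in\mathbb Z}2^{k/r}\int_{\Delta_k}|\lambda'(\xi)|\,d\xi .$$ (ii) There is a constant $C<\infty$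 depending only on $p$ and $q$ such that the following holds. Let $(\lambda_k)_{k\in\mathbb Z}$ be a sequence of real numbers with $\lambda_k\to0$ as $|k|\to\infty$. Let $\|T_\lambda\|_{L_p(0,1)\to L_q(0,1)}\in[0,\infty]$ be the least $A$ such that for every $f\in L_p(0,1)$ with Fourier series $\sum_{k\in\mathbb Z}a_ke^{2\pi ikx}$ there is a function $T_\lambda f\in L_q(0,1)$ with Fourier series $\sum_{k\in\mathbb Z}\lambda_ka_ke^{2\pi ikx}$ and $\|T_\lambda f\|_{L_q(0,1)}\le A\|f\|_{L_p(0,1)}$ (with $A=\infty$ if for some $f$ there is no such function). Then $$\|T_\lambda\|_{L_p(0,1)\to L_q(0,1)}\le C\,\sup_{k\ge0}2^{k/r}\sum_{m=2^k}^{2^{k+1}-1}\bigl(|\lambda_{-m}-\lambda_{-m+1}|+|\lambda_m-\lambda_{m-1}|\bigr).$$ In both parts the right-hand side may be $+\infty$, in which case the inequality says nothing. -/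

import Mathlib

open MeasureTheory Set Filter Topology
open scoped NNReal ENNReal

namespace LizorkinMultiplier

/-- The Fourier transform `(2π)^(-1/2) ∫ f(x) e^(-ixξ) dx` on the real line. -/
noncomputable def fourierLine (f : ℝ → ℂ) (ξ : ℝ) : ℂ :=
  ((1 / Real.sqrt (2 * Real.pi) : ℝ) : ℂ) *
    ∫ x : ℝ, f x * Complex.exp (-(Complex.I * (x : ℂ) * (ξ : ℂ)))

/-- The inverse Fourier transform `(2π)^(-1/2) ∫ g(ξ) e^(ixξ) dξ` on the real line. -/
noncomputable def fourierLineInv (g : ℝ → ℂ) (x : ℝ) : ℂ :=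
  ((1 / Real.sqrt (2 * Real.pi) : ℝ) : ℂ) *
    ∫ ξ : ℝ, g ξ * Complex.exp (Complex.I * (x : ℂ) * (ξ : ℂ))

/-- The Fourier transform multiplier with symbol `lam`: multiply the Fourier transform of `f` by
`lam` and transform back. -/
noncomputable def lineMultiplier (lam : ℝ → ℂ) (f : ℝ → ℂ) : ℝ → ℂ :=
  fourierLineInv (fun ξ => lam ξ * fourierLine f ξ)

/-- The `L_p(ℝ) → L_q(ℝ)` norm (possibly `∞`) of the Fourier transform multiplier with symbol
`lam`: the least `C` such that `‖T f‖_q ≤ C ‖f‖_p` for all Schwartz functions `f`. The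
integrability requirement says that the integral defining `T f` makes sense; it holds for every
bounded measurable symbol, and if it fails the norm is `∞`. -/
noncomputable def lineMultiplierNorm (p q : ℝ) (lam : ℝ → ℂ) : ℝ≥0∞ :=
  sInf {C : ℝ≥0∞ | ∀ f : SchwartzMap ℝ ℂ,
    Integrable (fun ξ => lam ξ * fourierLine f ξ) volume ∧
    eLpNorm (lineMultiplier lam f) (ENNReal.ofReal q) volume
      ≤ C * eLpNorm f (ENNReal.ofReal p) volume}

/-- Lebesgue measure on `(0,1)`. -/
noncomputable def unitVolume : Measure ℝ := volume.restrict (Ioo (0 : ℝ) 1)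

/-- `g` is the image of `f` under the Fourier series multiplier with symbol `lam`: the `k`-th
Fourier coefficient (with respect to `e^(2πikx)` on `(0,1)`) of `g` is `lam k` times that
of `f`. -/
def IsSeriesMultiplierImage (lam : ℤ → ℂ) (f g : ℝ → ℂ) : Prop :=
  ∀ k : ℤ, fourierCoeffOn (zero_lt_one (α := ℝ)) g k
    = lam k * fourierCoeffOn (zero_lt_one (α := ℝ)) f k

/-- The `L_p(0,1) → L_q(0,1)` norm (possibly `∞`) of the Fourier series multiplier with symbol
`lam`: the least `C` such that every `f ∈ L_p(0,1)` has an image `g ∈ L_q(0,1)`, and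
`‖g‖_q ≤ C ‖f‖_p`. It is `∞` if some `f ∈ L_p(0,1)` has no image in `L_q(0,1)`. -/
noncomputable def seriesMultiplierNorm (p q : ℝ) (lam : ℤ → ℂ) : ℝ≥0∞ :=
  sInf {C : ℝ≥0∞ | ∀ f : ℝ → ℂ, MemLp f (ENNReal.ofReal p) unitVolume →
    ∃ g : ℝ → ℂ, MemLp g (ENNReal.ofReal q) unitVolume ∧ IsSeriesMultiplierImage lam f g ∧
      eLpNorm g (ENNReal.ofReal q) unitVolume ≤ C * eLpNorm f (ENNReal.ofReal p) unitVolume}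

/-- The dyadic set `(-2^(k+1), -2^k] ∪ [2^k, 2^(k+1))`. -/
def dyadicSet (k : ℤ) : Set ℝ :=
  Ioc (-(2 : ℝ) ^ (k + 1)) (-(2 : ℝ) ^ k) ∪ Ico ((2 : ℝ) ^ k) ((2 : ℝ) ^ (k + 1))

/-- The quantity `sup_{k ∈ ℤ} 2^(k/r) ∫_{Δ_k} |lam'(ξ)| dξ`, with values in `[0,∞]`. -/
noncomputable def lineVariation (r : ℝ) (lam : ℝ → ℝ) : ℝ≥0∞ :=
  ⨆ k : ℤ, ENNReal.ofReal ((2 : ℝ) ^ ((k : ℝ) / r)) *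
    ∫⁻ ξ in dyadicSet k, ENNReal.ofReal |deriv lam ξ|

/-- The quantity
`sup_{k ≥ 0} 2^(k/r) ∑_{m=2^k}^{2^(k+1)-1} (|lam_{-m} - lam_{-m+1}| + |lam_m - lam_{m-1}|)`,
with values in `[0,∞]`. -/
noncomputable def seriesVariation (r : ℝ) (lam : ℤ → ℝ) : ℝ≥0∞ :=
  ⨆ k : ℕ, ENNReal.ofReal ((2 : ℝ) ^ ((k : ℝ) / r) *
    ∑ m ∈ Finset.Ico (2 ^ k) (2 ^ (k + 1)),
      (|lam (-(m : ℤ)) - lam (-(m : ℤ) + 1)| + |lam (m : ℤ) - lam ((m : ℤ) - 1)|))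

end LizorkinMultiplier

/-!
Write `α = 1/r = 1/p - 1/q`, so that `0 < α < 1`, and let `V` be the dyadic variation of the symbol.
No Littlewood–Paley theory and no Hilbert transform is needed: since `p < q`, both multipliers are
dominated *pointwise* by a fractional integral of `|f|`, of kernel `|x - y|^(α - 1)` on the line and
`dist(x - y, ℤ)^(α - 1)` on the circle, and the theorem follows from the
Hardy–Littlewood–Sobolev inequality.

Domination. The symbol vanishes at infinity, so it is a superposition of indicators of intervals
`[0, t]`, weighted by its derivative (or differences); in formulas, integrate (or sum) by parts. The
multiplier with symbol the indicator of `[0, t]` has a Dirichlet kernel, bounded by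
`min (t, 1 / |u|)` up to a constant. Hence `T f (x)` is bounded by the integral of `|f y|` against
`∫ |lam' t| min (|t|, 1 / |x - y|) dt`. A block `|t| ~ 2^k` contributes at most
`V 2^(-kα) min (2^k, 1 / |x - y|)` to the latter, and these numbers form two geometric series
with sum `O(V |x - y|^(α - 1))`: this is `exists_lintegral_mul_min_le`, which is also where a
supremum over `k`, rather than a sum, turns out to suffice. The two cases are
`exists_enorm_lineMultiplier_le` and `exists_oneSided_multiplier`; in the second the image is
constructed as the sum of the dominated series of partial Fourier sums.

The fractional integral. `exists_fractional_integral_bound` is proved for σ-finite measures and kernels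
with `∫_G k(x, y) ≤ A μ(G)^α` in each variable, by the layer cake method: the bilinear form on
superlevel sets is at most `A min (μ(F) μ(G)^α, μ(G) μ(F)^α)`, and the levels `(a, b)` are divided
along the curve `b = a^(p/s)`, where `s` is the exponent conjugate to `q`.
-/

namespace LizorkinMultiplier

/-! ### The Hardy–Littlewood–Sobolev inequality for kernels of weak type -/

lemma lintegral_Ioc_rpow_neg {γ B : ℝ} (hγ : γ < 1) (hB : 0 ≤ B) :
    ∫⁻ b in Ioc 0 B, ENNReal.ofReal (b ^ (-γ)) = ENNReal.ofReal (B ^ (1 - γ) / (1 - γ)) := by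
  rw [← ofReal_integral_eq_lintegral_ofReal]
  · rw [← intervalIntegral.integral_of_le hB, integral_rpow (Or.inl (by linarith)),
      Real.zero_rpow (by linarith)]
    congr 1
    rw [show -γ + 1 = 1 - γ by ring]; ring
  · have := (intervalIntegral.intervalIntegrable_rpow' (a := 0) (b := B) (r := -γ) (by linarith))
    rwa [intervalIntegrable_iff_integrableOn_Ioc_of_le hB] at this
  · filter_upwards [ae_restrict_mem measurableSet_Ioc] with b hb
    exact Real.rpow_nonneg hb.1.le _

/-- The part of the bilinear estimate that lies below the curve `b = a ^ (p / s)`. In applications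
`F` and `G` are distribution functions, and the hypotheses say that `∫ f ^ p ≤ 1` and
`∫ g ^ s ≤ 1` up to the factors `p` and `s`. -/
lemma lintegral_mul_lintegral_rpow_le {p s α : ℝ} (hp : 1 < p) (hs : 1 < s) (hα : 0 < α)
    (h : 1 / p + 1 / s = 1 + α) :
    ∃ C : ℝ≥0, ∀ F G : ℝ → ℝ≥0∞, Measurable F → Measurable G →
      ∫⁻ a in Ioi 0, F a * ENNReal.ofReal (a ^ (p - 1)) ≤ 1 →
      ∫⁻ b in Ioi 0, G b * ENNReal.ofReal (b ^ (s - 1)) ≤ 1 →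
      ∫⁻ a in Ioi 0, F a * ∫⁻ b in Ioc 0 (a ^ (p / s)), G b ^ α ≤ C := by
  have hp0 : 0 < p := by linarith
  have hs0 : 0 < s := by linarith
  have hp1 : 1 / p < 1 := by rw [div_lt_one hp0]; exact hp
  have hs1 : 1 / s < 1 := by rw [div_lt_one hs0]; exact hs
  have hα1 : α < 1 := by linarith
  have hsα : s * α < 1 := by
    have : α < 1 / s := by linarith
    rwa [lt_div_iff₀ hs0, mul_comm] at this
  set γ : ℝ := (s - 1) * α / (1 - α) with hγdef
  have h1α : 0 < 1 - α := by linarith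
  have hγ : γ < 1 := by rw [hγdef, div_lt_one h1α]; linarith
  have hexp : (p / s) * ((1 - γ) * (1 - α)) = p - 1 := by
    have h1 : (1 - γ) * (1 - α) = 1 - s * α := by rw [hγdef]; field_simp; ring
    have h2 : 1 / s = 1 + α - 1 / p := by linarith
    have h3 : p / s = p * (1 + α - 1 / p) := by rw [← h2]; ring
    rw [h1]
    have : p / s * (1 - s * α) = p / s - p * α := by field_simp
    rw [this, h3]; field_simp; ring
  refine ⟨((1 / (1 - γ)) ^ (1 - α)).toNNReal, fun F G hF hG hFi hGi => ?_⟩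
  set K : ℝ := (1 / (1 - γ)) ^ (1 - α) with hK
  -- Hölder with exponents `1 / α` and `1 / (1 - α)`, after splitting off the weight `b ^ (s - 1)`;
  -- the remaining power `b ^ (-γ)` is integrable at `0` because `s * α < 1`.
  have inner : ∀ a : ℝ, 0 < a →
      ∫⁻ b in Ioc 0 (a ^ (p / s)), G b ^ α ≤ ENNReal.ofReal K * ENNReal.ofReal (a ^ (p - 1)) := by
    intro a ha
    set B := a ^ (p / s) with hB
    have hB0 : 0 ≤ B := Real.rpow_nonneg ha.le _
    have hconj : (1 / α).HolderConjugate (1 / (1 - α)) := by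
      rw [Real.holderConjugate_iff]
      refine ⟨by rw [lt_div_iff₀ hα]; linarith, by field_simp; ring⟩
    calc ∫⁻ b in Ioc 0 B, G b ^ α
        = ∫⁻ b in Ioc 0 B, ((fun b => (G b * ENNReal.ofReal (b ^ (s - 1))) ^ α) *
            (fun b => ENNReal.ofReal (b ^ (-((s - 1) * α))))) b := by
          refine setLIntegral_congr_fun measurableSet_Ioc fun b hb => ?_
          have hb0 : 0 < b := hb.1
          simp only [Pi.mul_apply]
          rw [ENNReal.mul_rpow_of_nonneg _ _ hα.le, mul_assoc,
            ENNReal.ofReal_rpow_of_pos (Real.rpow_pos_of_pos hb0 _),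
            ← ENNReal.ofReal_mul (by positivity), ← Real.rpow_mul hb0.le, ← Real.rpow_add hb0]
          simp
      _ ≤ (∫⁻ b in Ioc 0 B, ((G b * ENNReal.ofReal (b ^ (s - 1))) ^ α) ^ (1 / α)) ^ (1 / (1 / α))
          * (∫⁻ b in Ioc 0 B, (ENNReal.ofReal (b ^ (-((s - 1) * α)))) ^ (1 / (1 - α)))
            ^ (1 / (1 / (1 - α))) := by
          apply ENNReal.lintegral_mul_le_Lp_mul_Lq _ hconj
          · fun_prop
          · fun_prop
      _ ≤ 1 * ENNReal.ofReal (K * a ^ (p - 1)) := by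
          rw [one_div_one_div, one_div_one_div]
          gcongr
          · have : ∫⁻ b in Ioc 0 B, ((G b * ENNReal.ofReal (b ^ (s - 1))) ^ α) ^ (1 / α) ≤ 1 := by
              refine le_trans ?_ hGi
              refine le_trans (lintegral_mono_set Ioc_subset_Ioi_self) (le_of_eq ?_)
              refine lintegral_congr fun b => ?_
              rw [← ENNReal.rpow_mul, mul_one_div_cancel hα.ne', ENNReal.rpow_one]
            calc _ ≤ (1 : ℝ≥0∞) ^ α := by gcongr
              _ = 1 := ENNReal.one_rpow _
          · have : ∫⁻ b in Ioc 0 B, (ENNReal.ofReal (b ^ (-((s - 1) * α)))) ^ (1 / (1 - α))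
                = ∫⁻ b in Ioc 0 B, ENNReal.ofReal (b ^ (-γ)) := by
              refine setLIntegral_congr_fun measurableSet_Ioc fun b hb => ?_
              have hb0 : 0 < b := hb.1
              rw [ENNReal.ofReal_rpow_of_pos (Real.rpow_pos_of_pos hb0 _),
                ← Real.rpow_mul hb0.le]
              congr 2
              rw [hγdef]; ring
            rw [this, lintegral_Ioc_rpow_neg hγ hB0,
              ENNReal.ofReal_rpow_of_nonneg (by have : 0 < 1 - γ := by linarith
                                                positivity) h1α.le]
            apply le_of_eq
            congr 1
            have : 0 < 1 - γ := by linarith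
            rw [div_eq_mul_one_div, Real.mul_rpow (by positivity) (by positivity),
              ← Real.rpow_mul hB0, hB, ← Real.rpow_mul ha.le, hexp, mul_comm]
      _ = _ := by
          have : 0 < 1 - γ := by linarith
          rw [one_mul, ENNReal.ofReal_mul (by positivity)]
  calc ∫⁻ a in Ioi 0, F a * ∫⁻ b in Ioc 0 (a ^ (p / s)), G b ^ α
      ≤ ∫⁻ a in Ioi 0, ENNReal.ofReal K * (F a * ENNReal.ofReal (a ^ (p - 1))) := by
        refine setLIntegral_mono' measurableSet_Ioi fun a ha => ?_
        refine (mul_le_mul_right (inner a ha) (F a)).trans (le_of_eq (by ring))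
    _ = ENNReal.ofReal K * ∫⁻ a in Ioi 0, (F a * ENNReal.ofReal (a ^ (p - 1))) := by
        rw [lintegral_const_mul]; fun_prop
    _ ≤ ENNReal.ofReal K * 1 := by gcongr
    _ = _ := by rw [mul_one]; rfl

/-- Layer cake formula with a weight `H`. -/
lemma lintegral_mul_eq_lintegral_superlevel {X : Type*} [MeasurableSpace X] {ν : Measure X}
    {g : X → ℝ≥0} (hg : Measurable g) {H : X → ℝ≥0∞} (hH : Measurable H) :
    ∫⁻ x, (g x : ℝ≥0∞) * H x ∂ν = ∫⁻ b in Ioi (0 : ℝ), ∫⁻ x in {x | b < g x}, H x ∂ν := by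
  have h := lintegral_eq_lintegral_meas_lt (ν.withDensity H) (f := fun x => (g x : ℝ))
    (ae_of_all _ fun x => (g x).2) (by fun_prop)
  rw [lintegral_withDensity_eq_lintegral_mul _ hH (by fun_prop)] at h
  simp only [Pi.mul_apply, ENNReal.ofReal_coe_nnreal] at h
  simp_rw [mul_comm (g _ : ℝ≥0∞), h]
  refine lintegral_congr fun b => ?_
  rw [withDensity_apply _ (measurableSet_lt measurable_const (by fun_prop))]

lemma lintegral_lintegral_indicator_le_rpow {F H : ℝ → ℝ≥0∞} (hH : Measurable H) (e : ℝ) :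
    ∫⁻ a in Ioi (0 : ℝ), ∫⁻ b in Ioi (0 : ℝ),
        {z : ℝ × ℝ | z.2 ≤ z.1 ^ e}.indicator (fun z => F z.1 * H z.2) (a, b) =
      ∫⁻ a in Ioi 0, F a * ∫⁻ b in Ioc 0 (a ^ e), H b := by
  refine lintegral_congr fun a => ?_
  have : ∀ b, {z : ℝ × ℝ | z.2 ≤ z.1 ^ e}.indicator (fun z => F z.1 * H z.2) (a, b) =
      (Iic (a ^ e)).indicator (fun b => F a * H b) b := fun b => rfl
  simp_rw [this]
  rw [setLIntegral_indicator measurableSet_Iic, lintegral_const_mul _ hH, inter_comm,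
    Ioi_inter_Iic]

/-- Splitting of the quadrant of levels along the curve `b = a ^ (p / s)`: each term of the minimum
is used on the side where it is integrable. -/
lemma lintegral_lintegral_min_le {F G : ℝ → ℝ≥0∞} (hF : Measurable F) (hG : Measurable G)
    {p s : ℝ} (α : ℝ) (hp : 0 < p) (hs : 0 < s) :
    ∫⁻ b in Ioi (0 : ℝ), ∫⁻ a in Ioi (0 : ℝ), min (F a * G b ^ α) (G b * F a ^ α) ≤
      (∫⁻ a in Ioi 0, F a * ∫⁻ b in Ioc 0 (a ^ (p / s)), G b ^ α) +
      (∫⁻ b in Ioi 0, G b * ∫⁻ a in Ioc 0 (b ^ (s / p)), F a ^ α) := by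
  have hS : ∀ e : ℝ, MeasurableSet {z : ℝ × ℝ | z.2 ≤ z.1 ^ e} := fun e =>
    measurableSet_le (by fun_prop) (by fun_prop)
  have m1 : Measurable ({z : ℝ × ℝ | z.2 ≤ z.1 ^ (p / s)}.indicator
      (fun z => F z.1 * G z.2 ^ α)) := Measurable.indicator (by fun_prop) (hS _)
  have m2 : Measurable ({z : ℝ × ℝ | z.2 ≤ z.1 ^ (s / p)}.indicator
      (fun z => G z.1 * F z.2 ^ α)) := Measurable.indicator (by fun_prop) (hS _)
  rw [← lintegral_lintegral_indicator_le_rpow (H := fun b => G b ^ α) (by fun_prop),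
    ← lintegral_lintegral_indicator_le_rpow (H := fun b => F b ^ α) (by fun_prop),
    lintegral_lintegral_swap (f := fun a b => {z : ℝ × ℝ | z.2 ≤ z.1 ^ (p / s)}.indicator
      (fun z => F z.1 * G z.2 ^ α) (a, b)) m1.aemeasurable, ← lintegral_add_left]
  · refine setLIntegral_mono' measurableSet_Ioi fun b hb => ?_
    rw [← lintegral_add_left (by fun_prop)]
    refine setLIntegral_mono' measurableSet_Ioi fun a ha => ?_
    by_cases hab : b ≤ a ^ (p / s)
    · refine (min_le_left _ _).trans (le_add_right ?_)
      rw [indicator_of_mem (by exact hab)]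
    · refine (min_le_right _ _).trans (le_add_left ?_)
      have : a ≤ b ^ (s / p) := by
        have h := Real.rpow_le_rpow (Real.rpow_nonneg (le_of_lt ha) _) (not_le.1 hab).le
          (div_pos hs hp).le
        rwa [← Real.rpow_mul (le_of_lt ha), div_mul_div_cancel₀ hs.ne', div_self hp.ne',
          Real.rpow_one] at h
      rw [indicator_of_mem (by exact this)]
  · exact Measurable.lintegral_prod_left' (f := ({z : ℝ × ℝ | z.2 ≤ z.1 ^ (p / s)}.indicator
      (fun z => F z.1 * G z.2 ^ α))) m1

/-- The distribution function of a function with `∫ f ^ p ≤ 1`. The layer cake formula has a factor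
`p` in front of this integral, which may be dropped as `1 ≤ p`. -/
lemma lintegral_superlevel_rpow_le_one {X : Type*} [MeasurableSpace X] {μ : Measure X} {p : ℝ}
    (hp : 1 ≤ p) {f : X → ℝ≥0} (hf : Measurable f) (h : ∫⁻ x, (f x : ℝ≥0∞) ^ p ∂μ ≤ 1) :
    ∫⁻ a in Ioi (0 : ℝ), μ {x | a < f x} * ENNReal.ofReal (a ^ (p - 1)) ≤ 1 := by
  have hp0 : 0 < p := by linarith
  have e := lintegral_rpow_eq_lintegral_meas_lt_mul μ (f := fun x => (f x : ℝ))
    (ae_of_all _ fun x => (f x).2) (by fun_prop) hp0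
  have e2 : ∀ x, ENNReal.ofReal ((f x : ℝ) ^ p) = (f x : ℝ≥0∞) ^ p := fun x => by
    rw [← ENNReal.ofReal_rpow_of_nonneg (NNReal.coe_nonneg _) hp0.le, ENNReal.ofReal_coe_nnreal]
  simp_rw [e2] at e
  calc _ = 1 * ∫⁻ a in Ioi (0 : ℝ), μ {x | a < f x} * ENNReal.ofReal (a ^ (p - 1)) :=
        (one_mul _).symm
    _ ≤ ENNReal.ofReal p * ∫⁻ a in Ioi (0 : ℝ), μ {x | a < f x} * ENNReal.ofReal (a ^ (p - 1)) := by
        gcongr; simpa using hp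
    _ ≤ 1 := e ▸ h

/-- The bilinear form of the Hardy–Littlewood–Sobolev inequality, for normalized functions and a
kernel that satisfies the bound `A * μ G ^ α` over every set `G` in each variable. -/
lemma exists_bilinear_le {p s α : ℝ} (hp : 1 < p) (hs : 1 < s) (hα : 0 < α)
    (h : 1 / p + 1 / s = 1 + α) :
    ∃ C : ℝ≥0, ∀ (X : Type) [MeasurableSpace X] (μ : Measure X) [SFinite μ]
      (k : X → X → ℝ≥0∞) (_ : Measurable (Function.uncurry k)) (A : ℝ≥0∞)
      (_ : ∀ x, ∀ G, MeasurableSet G → ∫⁻ y in G, k x y ∂μ ≤ A * μ G ^ α)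
      (_ : ∀ y, ∀ G, MeasurableSet G → ∫⁻ x in G, k x y ∂μ ≤ A * μ G ^ α)
      (f g : X → ℝ≥0) (_ : Measurable f) (_ : Measurable g)
      (_ : ∫⁻ x, (f x : ℝ≥0∞) ^ p ∂μ ≤ 1) (_ : ∫⁻ x, (g x : ℝ≥0∞) ^ s ∂μ ≤ 1),
      ∫⁻ x, g x * ∫⁻ y, f y * k x y ∂μ ∂μ ≤ C * A := by
  obtain ⟨C₁, hC₁⟩ := lintegral_mul_lintegral_rpow_le hp hs hα h
  obtain ⟨C₂, hC₂⟩ := lintegral_mul_lintegral_rpow_le hs hp hα (by rw [add_comm]; exact h)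
  refine ⟨C₁ + C₂, fun X _ μ _ k hk A hx hy f g hf hg hfp hgs => ?_⟩
  have hfs : ∀ a : ℝ, MeasurableSet {x | a < f x} := fun a =>
    measurableSet_lt measurable_const (by fun_prop)
  have hgs' : ∀ a : ℝ, MeasurableSet {x | a < g x} := fun a =>
    measurableSet_lt measurable_const (by fun_prop)
  set F : ℝ → ℝ≥0∞ := fun a => μ {x | a < f x} with hF
  set G : ℝ → ℝ≥0∞ := fun a => μ {x | a < g x} with hG
  have hFm : Measurable F := Antitone.measurable fun a b hab =>
    measure_mono fun x (hx : b < f x) => lt_of_le_of_lt hab hx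
  have hGm : Measurable G := Antitone.measurable fun a b hab =>
    measure_mono fun x (hx : b < g x) => lt_of_le_of_lt hab hx
  have hkf : Measurable (Function.uncurry fun x y => (f y : ℝ≥0∞) * k x y) := by
    have : Measurable fun z : X × X => (f z.2 : ℝ≥0∞) * Function.uncurry k z := by fun_prop
    exact this
  have hint : Measurable fun x => ∫⁻ y, f y * k x y ∂μ := hkf.lintegral_prod_right
  have hM1 : ∀ a b : ℝ, ∫⁻ y in {y | a < f y}, ∫⁻ x in {x | b < g x}, k x y ∂μ ∂μ
      ≤ A * (F a * G b ^ α) := fun a b => by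
    calc _ ≤ ∫⁻ y in {y | a < f y}, A * G b ^ α ∂μ :=
          lintegral_mono fun y => hy y _ (hgs' b)
      _ = _ := by rw [lintegral_const, Measure.restrict_apply_univ]; ring
  have hM2 : ∀ a b : ℝ, ∫⁻ y in {y | a < f y}, ∫⁻ x in {x | b < g x}, k x y ∂μ ∂μ
      ≤ A * (G b * F a ^ α) := fun a b => by
    rw [lintegral_lintegral_swap (f := fun y x => k x y) (hk.comp measurable_swap).aemeasurable]
    calc _ ≤ ∫⁻ x in {x | b < g x}, A * F a ^ α ∂μ :=
          lintegral_mono fun x => hx x _ (hfs a)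
      _ = _ := by rw [lintegral_const, Measure.restrict_apply_univ]; ring
  have hstep : ∀ b : ℝ, ∫⁻ x in {x | b < g x}, ∫⁻ y, f y * k x y ∂μ ∂μ =
      ∫⁻ a in Ioi (0 : ℝ), ∫⁻ y in {y | a < f y}, ∫⁻ x in {x | b < g x}, k x y ∂μ ∂μ := fun b => by
    rw [lintegral_lintegral_swap hkf.aemeasurable]
    have : ∀ y, ∫⁻ x in {x | b < g x}, f y * k x y ∂μ = f y * ∫⁻ x in {x | b < g x}, k x y ∂μ :=
      fun y => lintegral_const_mul _ hk.of_uncurry_right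
    simp_rw [this]
    exact lintegral_mul_eq_lintegral_superlevel hf (hk.lintegral_prod_left)
  calc ∫⁻ x, g x * ∫⁻ y, f y * k x y ∂μ ∂μ
      = ∫⁻ b in Ioi (0 : ℝ), ∫⁻ a in Ioi (0 : ℝ),
          ∫⁻ y in {y | a < f y}, ∫⁻ x in {x | b < g x}, k x y ∂μ ∂μ := by
        rw [lintegral_mul_eq_lintegral_superlevel hg hint]
        exact lintegral_congr hstep
    _ ≤ ∫⁻ b in Ioi (0 : ℝ), ∫⁻ a in Ioi (0 : ℝ), A * min (F a * G b ^ α) (G b * F a ^ α) := by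
        refine lintegral_mono fun b => lintegral_mono fun a => ?_
        rw [mul_min]
        exact le_min (hM1 a b) (hM2 a b)
    _ = A * ∫⁻ b in Ioi (0 : ℝ), ∫⁻ a in Ioi (0 : ℝ), min (F a * G b ^ α) (G b * F a ^ α) := by
        have hm : Measurable fun z : ℝ × ℝ => min (F z.2 * G z.1 ^ α) (G z.1 * F z.2 ^ α) := by
          fun_prop
        rw [← lintegral_const_mul _ hm.lintegral_prod_right']
        refine lintegral_congr fun b => ?_
        rw [lintegral_const_mul]
        fun_prop
    _ ≤ A * (C₁ + C₂) := by
        gcongr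
        refine (lintegral_lintegral_min_le hFm hGm α (by linarith) (by linarith)
          (p := p) (s := s)).trans ?_
        gcongr
        · exact hC₁ F G hFm hGm (lintegral_superlevel_rpow_le_one hp.le hf hfp)
            (lintegral_superlevel_rpow_le_one hs.le hg hgs)
        · exact hC₂ G F hGm hFm (lintegral_superlevel_rpow_le_one hs.le hg hgs)
            (lintegral_superlevel_rpow_le_one hp.le hf hfp)
    _ = _ := by rw [mul_comm]; push_cast; rfl

/-- The Hardy–Littlewood–Sobolev inequality for a function of norm at most one, from the bilinear
form by duality. -/
lemma exists_lintegral_rpow_le_of_le_one {p q α : ℝ} (hp : 1 < p) (hpq : p < q)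
    (hα : α = 1 / p - 1 / q) :
    ∃ C : ℝ≥0, ∀ (X : Type) [MeasurableSpace X] (μ : Measure X) [SigmaFinite μ]
      (k : X → X → ℝ≥0∞) (_ : Measurable (Function.uncurry k)) (A : ℝ≥0)
      (_ : ∀ x, ∀ G, MeasurableSet G → ∫⁻ y in G, k x y ∂μ ≤ A * μ G ^ α)
      (_ : ∀ y, ∀ G, MeasurableSet G → ∫⁻ x in G, k x y ∂μ ≤ A * μ G ^ α)
      (f : X → ℝ≥0) (_ : Measurable f) (_ : ∫⁻ x, (f x : ℝ≥0∞) ^ p ∂μ ≤ 1),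
      ∫⁻ x, (∫⁻ y, f y * k x y ∂μ) ^ q ∂μ ≤ (C * A) ^ q := by
  have hp0 : 0 < p := by linarith
  have hq1 : 1 < q := by linarith
  have hq0 : 0 < q := by linarith
  set s : ℝ := q / (q - 1) with hs
  have hs1 : 1 < s := by rw [hs, lt_div_iff₀ (by linarith)]; linarith
  have hinv : 1 / s = 1 - 1 / q := by rw [hs]; field_simp
  have hα0 : 0 < α := by
    rw [hα, sub_pos]; exact one_div_lt_one_div_of_lt hp0 hpq
  obtain ⟨C, hC⟩ := exists_bilinear_le hp hs1 hα0 (by rw [hinv, hα]; ring)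
  refine ⟨C, fun X _ μ _ k hk A hx hy f hf hfp => ?_⟩
  have hkf : Measurable (Function.uncurry fun x y => (f y : ℝ≥0∞) * k x y) := by
    have : Measurable fun z : X × X => (f z.2 : ℝ≥0∞) * Function.uncurry k z := by fun_prop
    exact this
  set T : X → ℝ≥0∞ := fun x => ∫⁻ y, f y * k x y ∂μ with hT
  have hTm : Measurable T := hkf.lintegral_prod_right
  set S : ℕ → Set X := spanningSets μ
  have hSm : ∀ n, MeasurableSet (S n) := measurableSet_spanningSets μ
  -- The image is truncated in height and support, so that the dual function can be normalized
  -- by a finite quantity.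
  set t : ℕ → X → ℝ≥0∞ := fun n => (S n).indicator fun x => min (T x) n with ht
  have htm : ∀ n, Measurable (t n) := fun n => Measurable.indicator (by fun_prop) (hSm n)
  have htT : ∀ n x, t n x ≤ T x := fun n x =>
    (indicator_le_self' (fun _ _ => zero_le) x).trans (min_le_left _ _)
  have htn : ∀ n x, t n x ≤ n := fun n x =>
    (indicator_le_self' (fun _ _ => zero_le) x).trans (min_le_right _ _)
  have httop : ∀ n x, t n x ≠ ∞ := fun n x => ne_top_of_le_ne_top (by simp) (htn n x)
  have hbound : ∀ n, ∫⁻ x, t n x ^ q ∂μ ≤ (C * A) ^ q := by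
    intro n
    set N := ∫⁻ x, t n x ^ q ∂μ with hN
    by_cases hN0 : N = 0
    · rw [hN0]; exact zero_le
    have hNtop : N ≠ ∞ := by
      have : N ≤ ∫⁻ x in S n, (n : ℝ≥0∞) ^ q ∂μ := by
        rw [← lintegral_indicator (hSm n)]
        refine lintegral_mono fun x => ?_
        by_cases hxS : x ∈ S n
        · rw [indicator_of_mem hxS]; gcongr; exact htn n x
        · simp [ht, hxS, hq0]
      refine ne_top_of_le_ne_top ?_ this
      rw [setLIntegral_const]
      exact ENNReal.mul_ne_top (ENNReal.rpow_ne_top_of_nonneg hq0.le (by simp))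
        (measure_spanningSets_lt_top μ n).ne
    -- The function of norm one in the conjugate space that norms the truncation.
    set g : X → ℝ≥0 := fun x => (t n x ^ (q - 1) * N ^ (-(1 / s))).toNNReal with hg
    have hgc : ∀ x, (g x : ℝ≥0∞) = t n x ^ (q - 1) * N ^ (-(1 / s)) := fun x => by
      rw [hg, ENNReal.coe_toNNReal]
      refine ENNReal.mul_ne_top (ENNReal.rpow_ne_top_of_nonneg (by linarith) (httop n x)) ?_
      exact ENNReal.rpow_ne_top_of_ne_zero hN0 hNtop
    have hgm : Measurable g := by
      have := htm n
      fun_prop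
    have hgs : ∫⁻ x, (g x : ℝ≥0∞) ^ s ∂μ ≤ 1 := by
      have : ∀ x, (g x : ℝ≥0∞) ^ s = t n x ^ q * N⁻¹ := fun x => by
        rw [hgc, ENNReal.mul_rpow_of_nonneg _ _ (by linarith), ← ENNReal.rpow_mul,
          ← ENNReal.rpow_mul]
        have e1 : (q - 1) * s = q := by
          rw [hs]; field_simp [show q - 1 ≠ 0 by linarith]
        have e2 : -(1 / s) * s = -1 := by field_simp
        rw [e1, e2, ENNReal.rpow_neg_one]
      simp_rw [this]
      rw [lintegral_mul_const _ (by have := htm n; fun_prop), ENNReal.mul_inv_cancel hN0 hNtop]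
    have key := hC X μ k hk A hx hy f g hf hgm hfp hgs
    have : N ^ (1 / q) ≤ C * A := by
      refine le_trans ?_ key
      have e : N ^ (1 / q) = ∫⁻ x, t n x ^ q * N ^ (-(1 / s)) ∂μ := by
        rw [lintegral_mul_const _ (by have := htm n; fun_prop), ← hN, hinv]
        nth_rewrite 2 [← ENNReal.rpow_one N]
        rw [← ENNReal.rpow_add _ _ hN0 hNtop]
        congr 1; ring
      rw [e]
      refine lintegral_mono fun x => ?_
      rw [hgc]
      have : t n x ^ q = t n x ^ (q - 1) * t n x := by
        conv_lhs => rw [show q = (q - 1) + 1 by ring]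
        rw [ENNReal.rpow_add_of_nonneg _ _ (by linarith) zero_le_one, ENNReal.rpow_one]
      rw [this, mul_right_comm]
      gcongr
      exact htT n x
    calc N = (N ^ (1 / q)) ^ q := by
          rw [← ENNReal.rpow_mul, one_div_mul_cancel hq0.ne', ENNReal.rpow_one]
      _ ≤ _ := by gcongr
  have hmono : Monotone fun n x => t n x ^ q := by
    intro n m hnm x
    refine ENNReal.rpow_le_rpow ?_ hq0.le
    simp only [ht]
    refine (indicator_le_indicator_of_subset (monotone_spanningSets μ hnm)
      (fun _ => zero_le) x).trans (indicator_le_indicator ?_)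
    gcongr
  have hsup : ∀ x, ⨆ n, t n x ^ q = T x ^ q := by
    intro x
    refine iSup_eq_of_tendsto (fun n m hnm => hmono hnm x) ?_
    refine Tendsto.ennrpow_const q ?_
    have : Tendsto (fun n : ℕ => min (T x) (n : ℝ≥0∞)) atTop (𝓝 (min (T x) ∞)) :=
      tendsto_const_nhds.min ENNReal.tendsto_nat_nhds_top
    rw [min_eq_left le_top] at this
    refine this.congr' ?_
    filter_upwards [eventually_ge_atTop (spanningSetsIndex μ x)] with n hn
    simp only [ht]
    rw [indicator_of_mem (mem_spanningSets_of_index_le μ x hn)]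
  calc ∫⁻ x, T x ^ q ∂μ = ∫⁻ x, ⨆ n, t n x ^ q ∂μ := by simp_rw [hsup]
    _ = ⨆ n, ∫⁻ x, t n x ^ q ∂μ :=
        lintegral_iSup (fun n => by have := htm n; fun_prop) hmono
    _ ≤ _ := iSup_le hbound

/-- The Hardy–Littlewood–Sobolev inequality: an integral operator whose kernel satisfies
`∫_G k ≤ A * μ G ^ α` in each variable maps `L_p` to `L_q` if `α = 1 / p - 1 / q`. -/
theorem exists_fractional_integral_bound {p q α : ℝ} (hp : 1 < p) (hpq : p < q)
    (hα : α = 1 / p - 1 / q) :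
    ∃ C : ℝ≥0, ∀ (X : Type) [MeasurableSpace X] (μ : Measure X) [SigmaFinite μ]
      (k : X → X → ℝ≥0∞) (_ : Measurable (Function.uncurry k)) (A : ℝ≥0)
      (_ : ∀ x, ∀ G, MeasurableSet G → ∫⁻ y in G, k x y ∂μ ≤ A * μ G ^ α)
      (_ : ∀ y, ∀ G, MeasurableSet G → ∫⁻ x in G, k x y ∂μ ≤ A * μ G ^ α)
      (E : Type) [NormedAddCommGroup E] (f : X → E),
      MemLp f (ENNReal.ofReal p) μ →
      eLpNorm (fun x => ∫⁻ y, ‖f y‖ₑ * k x y ∂μ) (ENNReal.ofReal q) μ ≤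
        C * A * eLpNorm f (ENNReal.ofReal p) μ := by
  have hp0 : 0 < p := by linarith
  have hq0 : 0 < q := by linarith
  obtain ⟨C, hC⟩ := exists_lintegral_rpow_le_of_le_one hp hpq hα
  refine ⟨C, fun X _ μ _ k hk A hx hy E _ f hf => ?_⟩
  set N := eLpNorm f (ENNReal.ofReal p) μ with hN
  by_cases hN0 : N = 0
  · have hf0 : f =ᵐ[μ] 0 := (eLpNorm_eq_zero_iff hf.1 (by simpa using hp0)).1 hN0
    have : (fun x => ∫⁻ y, ‖f y‖ₑ * k x y ∂μ) = 0 := by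
      funext x
      refine (lintegral_congr_ae ?_).trans lintegral_zero
      filter_upwards [hf0] with y hy
      simp [hy]
    rw [this, eLpNorm_zero]; exact zero_le
  have hNtop : N ≠ ∞ := hf.2.ne
  have hfe : AEMeasurable (fun y => ‖f y‖₊) μ := hf.1.nnnorm.aemeasurable
  set f₀ : X → ℝ≥0 := fun y => hfe.mk _ y / N.toNNReal with hf₀
  have hNc : (N.toNNReal : ℝ≥0∞) = N := ENNReal.coe_toNNReal hNtop
  have hNn0 : N.toNNReal ≠ 0 := fun h => hN0 (by rw [← hNc, h]; rfl)
  have hf₀c : ∀ᵐ y ∂μ, (f₀ y : ℝ≥0∞) = ‖f y‖ₑ * N⁻¹ := by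
    filter_upwards [hfe.ae_eq_mk] with y hy
    rw [hf₀]
    simp only
    rw [← hy, ENNReal.coe_div hNn0, hNc, div_eq_mul_inv]; rfl
  have hf₀m : Measurable f₀ := hfe.measurable_mk.div_const _
  have hNp : N ^ p = ∫⁻ y, ‖f y‖ₑ ^ p ∂μ := by
    rw [hN, eLpNorm_eq_lintegral_rpow_enorm_toReal (by simpa using hp0) ENNReal.ofReal_ne_top,
      ENNReal.toReal_ofReal hp0.le, ← ENNReal.rpow_mul, one_div_mul_cancel hp0.ne',
      ENNReal.rpow_one]
  have hone : ∫⁻ y, (f₀ y : ℝ≥0∞) ^ p ∂μ ≤ 1 := by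
    have : ∫⁻ y, (f₀ y : ℝ≥0∞) ^ p ∂μ = ∫⁻ y, ‖f y‖ₑ ^ p * (N⁻¹) ^ p ∂μ := by
      refine lintegral_congr_ae ?_
      filter_upwards [hf₀c] with y hy
      rw [hy, ENNReal.mul_rpow_of_nonneg _ _ hp0.le]
    rw [this, lintegral_mul_const' _ _ (ENNReal.rpow_ne_top_of_nonneg hp0.le (by simpa using hN0)),
      ← hNp, ← ENNReal.mul_rpow_of_nonneg _ _ hp0.le, ENNReal.mul_inv_cancel hN0 hNtop,
      ENNReal.one_rpow]
  have key := hC X μ k hk A hx hy f₀ hf₀m hone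
  have hT : (fun x => ∫⁻ y, ‖f y‖ₑ * k x y ∂μ) =
      fun x => N * ∫⁻ y, f₀ y * k x y ∂μ := by
    funext x
    rw [← lintegral_const_mul' _ _ hNtop]
    refine lintegral_congr_ae ?_
    filter_upwards [hf₀c] with y hy
    rw [hy, mul_comm _ N⁻¹, ← mul_assoc, ← mul_assoc, ENNReal.mul_inv_cancel hN0 hNtop, one_mul]
  rw [hT, eLpNorm_eq_lintegral_rpow_enorm_toReal (by simpa using hq0) ENNReal.ofReal_ne_top,
    ENNReal.toReal_ofReal hq0.le]
  simp only [enorm_eq_self, ENNReal.mul_rpow_of_nonneg _ _ hq0.le]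
  rw [lintegral_const_mul' _ _ (ENNReal.rpow_ne_top_of_nonneg hq0.le hNtop),
    ENNReal.mul_rpow_of_nonneg _ _ (by positivity), ← ENNReal.rpow_mul,
    mul_one_div_cancel hq0.ne', ENNReal.rpow_one, mul_comm]
  gcongr
  calc _ ≤ ((C * A : ℝ≥0∞) ^ q) ^ (1 / q) := by gcongr
    _ = _ := by rw [← ENNReal.rpow_mul, mul_one_div_cancel hq0.ne', ENNReal.rpow_one]

/-! ### Dyadic summation and the Riesz kernel -/

lemma summable_int_min_two_zpow_mul_rpow {α : ℝ} (hα : 0 < α) (hα1 : α < 1) :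
    Summable fun j : ℤ => min ((2 : ℝ) ^ j) 1 * (2 : ℝ) ^ (-((j : ℝ) * α)) := by
  have geo : ∀ β : ℝ, 0 < β → Summable fun n : ℕ => (2 : ℝ) ^ (-((n : ℝ) * β)) := fun β hβ => by
    have h : Summable fun n : ℕ => ((2 : ℝ) ^ (-β)) ^ n :=
      summable_geometric_of_lt_one (by positivity)
        (Real.rpow_lt_one_of_one_lt_of_neg one_lt_two (by linarith))
    refine h.congr fun n => ?_
    rw [← Real.rpow_natCast, ← Real.rpow_mul (by norm_num)]
    congr 1; ring
  refine Summable.of_nat_of_neg ?_ ?_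
  · refine Summable.of_nonneg_of_le (fun n => by positivity) (fun n => ?_) (geo α hα)
    refine mul_le_of_le_one_left (by positivity) (min_le_right _ _)
  · refine Summable.of_nonneg_of_le (fun n => by positivity) (fun n => ?_)
      (geo (1 - α) (by linarith))
    refine (mul_le_mul_of_nonneg_right (min_le_left _ _) (by positivity)).trans (le_of_eq ?_)
    rw [← Real.rpow_intCast, ← Real.rpow_add (by norm_num)]
    congr 1; push_cast; ring

/-- If a weight `w` has mass at most `V * 2 ^ (-k * α)` where `τ` is of size `2 ^ k`, for all `k`, then
the integral of `w * min τ D` is at most a multiple of `V * D ^ (1 - α)`: the dyadic blocks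
contribute a series that decreases geometrically on both sides of the block of `D`. -/
lemma exists_lintegral_mul_min_le {α : ℝ} (hα : 0 < α) (hα1 : α < 1) :
    ∃ C : ℝ≥0, ∀ (X : Type) [MeasurableSpace X] (μ : Measure X) (w : X → ℝ≥0∞) (τ : X → ℝ)
      (_ : Measurable τ) (_ : ∀ x, 0 ≤ τ x) (V : ℝ≥0∞)
      (_ : ∀ k : ℤ, ENNReal.ofReal ((2 : ℝ) ^ ((k : ℝ) * α)) *
        ∫⁻ x in τ ⁻¹' Ico ((2 : ℝ) ^ k) ((2 : ℝ) ^ (k + 1)), w x ∂μ ≤ V) (D : ℝ) (_ : 0 < D),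
      ∫⁻ x, w x * ENNReal.ofReal (min (τ x) D) ∂μ ≤ C * V * ENNReal.ofReal (D ^ (1 - α)) := by
  have hsum := summable_int_min_two_zpow_mul_rpow hα hα1
  set h : ℤ → ℝ := fun j => min ((2 : ℝ) ^ j) 1 * (2 : ℝ) ^ (-((j : ℝ) * α)) with hh
  have hh0 : ∀ j, 0 ≤ h j := fun j => by positivity
  refine ⟨(2 * ∑' j, h j).toNNReal, fun X _ μ w τ hτ hτ0 V hV D hD => ?_⟩
  -- `2 ^ k₀` is the dyadic size of `D`; the sum over `k` is compared with a fixed one by a shift.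
  obtain ⟨k₀, hk₀, hk₀'⟩ := exists_mem_Ico_zpow hD one_lt_two
  set S : ℤ → Set X := fun k => τ ⁻¹' Ico ((2 : ℝ) ^ k) ((2 : ℝ) ^ (k + 1)) with hS
  have hSm : ∀ k, MeasurableSet (S k) := fun k => hτ measurableSet_Ico
  have hpiece : ∀ k, ∫⁻ x in S k, w x ∂μ ≤ ENNReal.ofReal ((2 : ℝ) ^ (-((k : ℝ) * α))) * V := by
    intro k
    have hpos : (0 : ℝ) < (2 : ℝ) ^ ((k : ℝ) * α) := by positivity
    calc ∫⁻ x in S k, w x ∂μ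
        = ENNReal.ofReal ((2 : ℝ) ^ (-((k : ℝ) * α))) *
          (ENNReal.ofReal ((2 : ℝ) ^ ((k : ℝ) * α)) * ∫⁻ x in S k, w x ∂μ) := by
          rw [← mul_assoc, ← ENNReal.ofReal_mul (by positivity), ← Real.rpow_add (by norm_num)]
          simp
      _ ≤ _ := by gcongr; exact hV k
  have hterm : ∀ k, ∫⁻ x in S k, w x * ENNReal.ofReal (min (τ x) D) ∂μ ≤
      ENNReal.ofReal (2 * D ^ (1 - α)) * V * ENNReal.ofReal (h (k - k₀)) := by
    intro k
    calc ∫⁻ x in S k, w x * ENNReal.ofReal (min (τ x) D) ∂μ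
        ≤ ∫⁻ x in S k, w x * ENNReal.ofReal (2 * (2 : ℝ) ^ k₀ * min ((2 : ℝ) ^ (k - k₀)) 1) ∂μ := by
          refine setLIntegral_mono' (hSm k) fun x hx => ?_
          gcongr
          have e : 2 * (2 : ℝ) ^ k₀ * min ((2 : ℝ) ^ (k - k₀)) 1 =
              min ((2 : ℝ) ^ (k + 1)) ((2 : ℝ) ^ (k₀ + 1)) := by
            rw [mul_min_of_nonneg _ _ (by positivity), mul_one, zpow_add_one₀ (by norm_num),
              zpow_add_one₀ (by norm_num), zpow_sub₀ (by norm_num)]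
            congr 1
            · field_simp
            · ring
          rw [e]
          exact min_le_min hx.2.le hk₀'.le
      _ = (∫⁻ x in S k, w x ∂μ) *
          ENNReal.ofReal (2 * (2 : ℝ) ^ k₀ * min ((2 : ℝ) ^ (k - k₀)) 1) := by
          rw [lintegral_mul_const' _ _ ENNReal.ofReal_ne_top]
      _ ≤ ENNReal.ofReal ((2 : ℝ) ^ (-((k : ℝ) * α))) * V *
          ENNReal.ofReal (2 * (2 : ℝ) ^ k₀ * min ((2 : ℝ) ^ (k - k₀)) 1) := by
          gcongr; exact hpiece k
      _ = ENNReal.ofReal (2 * ((2 : ℝ) ^ k₀) ^ (1 - α)) * V * ENNReal.ofReal (h (k - k₀)) := by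
          have e : (2 : ℝ) ^ (-((k : ℝ) * α)) * (2 * (2 : ℝ) ^ k₀ * min ((2 : ℝ) ^ (k - k₀)) 1) =
              2 * ((2 : ℝ) ^ k₀) ^ (1 - α) * h (k - k₀) := by
            have : (2 : ℝ) ^ (-((k : ℝ) * α)) * (2 : ℝ) ^ k₀ =
                ((2 : ℝ) ^ k₀) ^ (1 - α) * (2 : ℝ) ^ (-(((k - k₀ : ℤ) : ℝ) * α)) := by
              rw [← Real.rpow_intCast, ← Real.rpow_mul (by norm_num), ← Real.rpow_add (by norm_num),
                ← Real.rpow_add (by norm_num)]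
              congr 1; push_cast; ring
            rw [hh]
            linear_combination (2 * min ((2 : ℝ) ^ (k - k₀)) 1) * this
          rw [mul_right_comm, mul_right_comm (ENNReal.ofReal (2 * _)),
            ← ENNReal.ofReal_mul (by positivity), e, ENNReal.ofReal_mul (by positivity)]
      _ ≤ _ := by gcongr
  have hcover : ∫⁻ x, w x * ENNReal.ofReal (min (τ x) D) ∂μ ≤
      ∫⁻ x in ⋃ k, S k, w x * ENNReal.ofReal (min (τ x) D) ∂μ := by
    rw [← lintegral_indicator (MeasurableSet.iUnion hSm)]
    refine lintegral_mono fun x => ?_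
    rcases (hτ0 x).eq_or_lt with h0 | h0
    -- The blocks miss the set `τ = 0`, where the integrand vanishes.
    · simp [← h0, hD.le]
    · obtain ⟨k, hk⟩ := exists_mem_Ico_zpow h0 one_lt_two
      rw [indicator_of_mem (mem_iUnion.2 ⟨k, hk⟩)]
  have hshift : ∑' k, ENNReal.ofReal (h (k - k₀)) = ENNReal.ofReal (∑' j, h j) := by
    rw [ENNReal.ofReal_tsum_of_nonneg hh0 hsum]
    exact (Equiv.subRight k₀).tsum_eq fun j => ENNReal.ofReal (h j)
  calc _ ≤ _ := hcover
    _ ≤ ∑' k, ∫⁻ x in S k, w x * ENNReal.ofReal (min (τ x) D) ∂μ := lintegral_iUnion_le _ _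
    _ ≤ ∑' k, ENNReal.ofReal (2 * D ^ (1 - α)) * V * ENNReal.ofReal (h (k - k₀)) :=
        ENNReal.tsum_le_tsum hterm
    _ = ENNReal.ofReal (2 * D ^ (1 - α)) * V * ENNReal.ofReal (∑' j, h j) := by
        rw [ENNReal.tsum_mul_left, hshift]
    _ = _ := by
        change _ = ENNReal.ofReal _ * V * _
        rw [ENNReal.ofReal_mul (by norm_num), ENNReal.ofReal_mul (by norm_num)]
        ring

/-- Among sets of given measure, the integral of the Riesz kernel is controlled by that over a ball
around `x`. The real power takes the value `0` at `y = x`, which does not affect the integral. -/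
lemma exists_setLIntegral_riesz_le {α : ℝ} (hα : 0 < α) (hα1 : α < 1) :
    ∃ A : ℝ≥0, ∀ (x : ℝ) (G : Set ℝ), MeasurableSet G →
      ∫⁻ y in G, ENNReal.ofReal (|x - y| ^ (α - 1)) ≤ A * volume G ^ α := by
  refine ⟨(2 / α + 1).toNNReal, fun x G hG => ?_⟩
  change _ ≤ ENNReal.ofReal _ * _
  have hApos : 0 < 2 / α + 1 := by positivity
  by_cases hG0 : volume G = 0
  · rw [Measure.restrict_eq_zero.2 hG0, lintegral_zero_measure]; exact zero_le
  by_cases hGtop : volume G = ∞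
  · rw [hGtop, ENNReal.top_rpow_of_pos hα, ENNReal.mul_top (by simpa using hApos)]
    exact le_top
  -- Within distance `R` of `x` integrate the kernel itself, farther away use that it is bounded.
  set R : ℝ := (volume G).toReal with hR
  have hR0 : 0 < R := ENNReal.toReal_pos hG0 hGtop
  have hGR : volume G = ENNReal.ofReal R := (ENNReal.ofReal_toReal hGtop).symm
  set I : ℝ → ℝ≥0∞ := (Ioc 0 R).indicator fun t => ENNReal.ofReal (t ^ (-(1 - α))) with hI
  have hIm : Measurable I := Measurable.indicator (by fun_prop) measurableSet_Ioc
  have hIint : ∫⁻ t, I t = ENNReal.ofReal (R ^ α / α) := by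
    rw [hI, lintegral_indicator measurableSet_Ioc, lintegral_Ioc_rpow_neg (by linarith) hR0.le]
    simp
  have hpt : ∀ t : ℝ, ENNReal.ofReal (|t| ^ (α - 1)) ≤
      I t + I (-t) + ENNReal.ofReal (R ^ (α - 1)) := by
    intro t
    by_cases ht : R < |t|
    · refine le_add_left (ENNReal.ofReal_le_ofReal ?_)
      exact Real.rpow_le_rpow_of_nonpos hR0 ht.le (by linarith)
    · push Not at ht
      refine le_add_right ?_
      rcases lt_trichotomy t 0 with h0 | h0 | h0
      · refine le_add_left ?_
        rw [abs_of_neg h0] at ht ⊢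
        rw [hI, indicator_of_mem (show -t ∈ Ioc 0 R from ⟨by linarith, ht⟩), neg_sub]
      · rw [h0, abs_zero, Real.zero_rpow (by linarith)]; simp
      · refine le_add_right ?_
        rw [abs_of_pos h0] at ht ⊢
        rw [hI, indicator_of_mem (show t ∈ Ioc 0 R from ⟨h0, ht⟩), neg_sub]
  calc ∫⁻ y in G, ENNReal.ofReal (|x - y| ^ (α - 1))
      ≤ ∫⁻ y in G, (I (x - y) + I (-(x - y)) + ENNReal.ofReal (R ^ (α - 1))) :=
        lintegral_mono fun y => hpt _
    _ = (∫⁻ y in G, (I (x - y) + I (-(x - y)))) + ENNReal.ofReal (R ^ (α - 1)) * volume G := by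
        rw [lintegral_add_right _ measurable_const, setLIntegral_const]
    _ ≤ (∫⁻ y, (I (x - y) + I (-(x - y)))) + ENNReal.ofReal (R ^ (α - 1)) * volume G := by
        gcongr; exact Measure.restrict_le_self
    _ = ENNReal.ofReal (2 / α + 1) * volume G ^ α := by
        rw [lintegral_add_left (by fun_prop), lintegral_sub_left_eq_self I x]
        simp_rw [neg_sub]
        rw [lintegral_sub_right_eq_self I x, hIint, hGR, ENNReal.ofReal_rpow_of_pos hR0,
          ← ENNReal.ofReal_mul (by positivity), ← ENNReal.ofReal_mul (by positivity),
          ← ENNReal.ofReal_add (by positivity) (by positivity),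
          ← ENNReal.ofReal_add (by positivity) (by positivity)]
        congr 1
        rw [Real.rpow_sub_one hR0.ne']
        field_simp; ring

/-! ### Multipliers on the line -/

lemma continuous_of_absolutelyContinuousOnInterval {lam : ℝ → ℝ}
    (hneg : ∀ b : ℝ, 0 < b → AbsolutelyContinuousOnInterval lam (-b) 0)
    (hpos : ∀ b : ℝ, 0 < b → AbsolutelyContinuousOnInterval lam 0 b) : Continuous lam := by
  refine continuous_iff_continuousAt.2 fun x => ?_
  have hb : 0 < |x| + 1 := by positivity
  have h1 := (hneg _ hb).continuousOn
  have h2 := (hpos _ hb).continuousOn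
  rw [uIcc_of_le (by linarith)] at h1 h2
  have h := h1.union_of_isClosed h2 isClosed_Icc isClosed_Icc
  rw [Icc_union_Icc_eq_Icc (by linarith) hb.le] at h
  exact h.continuousAt (Icc_mem_nhds (by linarith [neg_abs_le x]) (by linarith [le_abs_self x]))

lemma exists_norm_le_of_tendsto_cocompact {lam : ℝ → ℝ} (hc : Continuous lam)
    (hlim : Tendsto lam (cocompact ℝ) (𝓝 0)) : ∃ M, ∀ x, ‖lam x‖ ≤ M := by
  let L : ZeroAtInftyContinuousMap ℝ ℝ := ⟨⟨lam, hc⟩, hlim⟩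
  exact ⟨_, fun x => L.toBCF.norm_coe_le_norm x⟩

lemma intervalIntegral_mul_eq_sub {lam : ℝ → ℝ} {b : ℝ}
    (h : AbsolutelyContinuousOnInterval lam 0 b) {φ : ℝ → ℝ} (hφ : Continuous φ) :
    ∫ ξ in (0)..b, lam ξ * φ ξ =
      lam b * (∫ ξ in (0)..b, φ ξ) - ∫ t in (0)..b, deriv lam t * ∫ ξ in (0)..t, φ ξ := by
  have hΦ : AbsolutelyContinuousOnInterval (fun t => ∫ ξ in (0)..t, φ ξ) 0 b :=
    (hφ.intervalIntegrable _ _).absolutelyContinuousOnInterval_intervalIntegral (by simp)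
  have key := h.integral_mul_deriv_eq_deriv_mul hΦ
  simp only [hφ.deriv_integral, intervalIntegral.integral_same, mul_zero, sub_zero] at key
  exact key

/-- Integration by parts, with a complex-valued second factor. -/
lemma intervalIntegral_ofReal_mul_eq_sub {lam : ℝ → ℝ} {b : ℝ}
    (h : AbsolutelyContinuousOnInterval lam 0 b) {φ : ℝ → ℂ} (hφ : Continuous φ) :
    ∫ ξ in (0)..b, (lam ξ : ℂ) * φ ξ =
      lam b * (∫ ξ in (0)..b, φ ξ) - ∫ t in (0)..b, ((deriv lam t : ℝ) : ℂ) * ∫ ξ in (0)..t, φ ξ := by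
  have hre : Continuous fun ξ => (φ ξ).re := by fun_prop
  have him : Continuous fun ξ => (φ ξ).im := by fun_prop
  -- Mathlib has integration by parts for real-valued absolutely continuous functions; all integrals
  -- are separated into real and imaginary parts.
  have split : ∀ (g : ℝ → ℝ) (a b c : ℝ → ℝ) (t : ℝ),
      IntervalIntegrable (fun ξ => g ξ * a ξ) volume 0 t →
      IntervalIntegrable (fun ξ => g ξ * b ξ) volume 0 t →
      ∫ ξ in (0)..t, (g ξ : ℂ) * (a ξ + b ξ * Complex.I) =
        ((∫ ξ in (0)..t, g ξ * a ξ : ℝ) : ℂ) + ((∫ ξ in (0)..t, g ξ * b ξ : ℝ) : ℂ) * Complex.I := by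
    intro g a b c t ha hb
    rw [← intervalIntegral.integral_ofReal, ← intervalIntegral.integral_ofReal,
      ← intervalIntegral.integral_mul_const, ← intervalIntegral.integral_add]
    · refine intervalIntegral.integral_congr fun ξ _ => ?_
      push_cast; ring
    · exact ⟨ha.1.ofReal, ha.2.ofReal⟩
    · exact IntervalIntegrable.mul_const ⟨hb.1.ofReal, hb.2.ofReal⟩ _
  have hΦ : ∀ t, ∫ ξ in (0)..t, φ ξ = ((∫ ξ in (0)..t, (φ ξ).re : ℝ) : ℂ) +
      ((∫ ξ in (0)..t, (φ ξ).im : ℝ) : ℂ) * Complex.I := fun t => by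
    have := split (fun _ => 1) _ _ (fun _ => 1) t (by simpa using hre.intervalIntegrable _ _)
      (by simpa using him.intervalIntegrable _ _)
    simpa [Complex.re_add_im] using this
  have hd := h.intervalIntegrable_deriv
  have e1 := split lam _ _ (fun _ => 1) b
    (h.continuousOn.intervalIntegrable.mul_continuousOn hre.continuousOn)
    (h.continuousOn.intervalIntegrable.mul_continuousOn him.continuousOn)
  have e2 := split (deriv lam) (fun t => ∫ ξ in (0)..t, (φ ξ).re)
    (fun t => ∫ ξ in (0)..t, (φ ξ).im) (fun _ => 1) b
    (hd.mul_continuousOn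
      (intervalIntegral.continuous_primitive (fun _ _ => hre.intervalIntegrable _ _) 0).continuousOn)
    (hd.mul_continuousOn
      (intervalIntegral.continuous_primitive (fun _ _ => him.intervalIntegrable _ _) 0).continuousOn)
  simp only [← hΦ] at e2
  simp only [Complex.re_add_im] at e1
  rw [e1, e2, intervalIntegral_mul_eq_sub h hre, intervalIntegral_mul_eq_sub h him, hΦ b]
  push_cast; ring

lemma enorm_intervalIntegral_le_lintegral (f : ℝ → ℂ) (a b : ℝ) :
    ‖∫ t in a..b, f t‖ₑ ≤ ∫⁻ t, ‖f t‖ₑ := by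
  rw [← ofReal_norm, intervalIntegral.norm_intervalIntegral_eq, ofReal_norm]
  exact (enorm_integral_le_lintegral_enorm _).trans (lintegral_mono' Measure.restrict_le_self le_rfl)

/-- Integration by parts on the line: the boundary terms vanish at infinity, and the two half-lines
account for the factor `2`. -/
lemma enorm_integral_mul_le {lam : ℝ → ℝ}
    (hneg : ∀ b : ℝ, 0 < b → AbsolutelyContinuousOnInterval lam (-b) 0)
    (hpos : ∀ b : ℝ, 0 < b → AbsolutelyContinuousOnInterval lam 0 b)
    (hlim : Tendsto lam (cocompact ℝ) (𝓝 0)) {φ : ℝ → ℂ} (hφ : Continuous φ)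
    (hφi : Integrable φ) (hi : Integrable fun ξ => (lam ξ : ℂ) * φ ξ) :
    ‖∫ ξ, (lam ξ : ℂ) * φ ξ‖ₑ ≤ 2 * ∫⁻ t, ‖deriv lam t‖ₑ * ‖∫ ξ in (0)..t, φ ξ‖ₑ := by
  set L := ∫⁻ t, ‖deriv lam t‖ₑ * ‖∫ ξ in (0)..t, φ ξ‖ₑ with hL
  have hconv : Tendsto (fun b : ℝ => ∫ ξ in (-b)..b, (lam ξ : ℂ) * φ ξ) atTop
      (𝓝 (∫ ξ, (lam ξ : ℂ) * φ ξ)) :=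
    intervalIntegral_tendsto_integral hi tendsto_neg_atTop_atBot tendsto_id
  have hLb : ∀ b : ℝ, ‖∫ t in (0)..b, ((deriv lam t : ℝ) : ℂ) * ∫ ξ in (0)..t, φ ξ‖ₑ ≤ L := fun b => by
    refine (enorm_intervalIntegral_le_lintegral _ _ _).trans (le_of_eq ?_)
    refine lintegral_congr fun t => ?_
    rw [enorm_mul]
    congr 1
    simp [enorm_eq_nnnorm]
  have hΦ : ∀ b : ℝ, ‖∫ ξ in (0)..b, φ ξ‖ₑ ≤ ∫⁻ ξ, ‖φ ξ‖ₑ := fun b =>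
    enorm_intervalIntegral_le_lintegral _ _ _
  have hedge : Tendsto (fun b : ℝ => (‖lam b‖ₑ + ‖lam (-b)‖ₑ) * ∫⁻ ξ, ‖φ ξ‖ₑ) atTop (𝓝 0) := by
    have t1 : Tendsto (fun b : ℝ => ‖lam b‖ₑ) atTop (𝓝 0) := by
      have := ((hlim.mono_left atTop_le_cocompact).enorm)
      simpa using this
    have t2 : Tendsto (fun b : ℝ => ‖lam (-b)‖ₑ) atTop (𝓝 0) := by
      have := ((hlim.mono_left atBot_le_cocompact).comp tendsto_neg_atTop_atBot).enorm
      simpa using this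
    have := ENNReal.Tendsto.mul_const (t1.add t2) (b := ∫⁻ ξ, ‖φ ξ‖ₑ) (Or.inr hφi.2.ne)
    simpa using this
  have hbd : ∀ᶠ b : ℝ in atTop, ‖∫ ξ in (-b)..b, (lam ξ : ℂ) * φ ξ‖ₑ ≤
      (‖lam b‖ₑ + ‖lam (-b)‖ₑ) * (∫⁻ ξ, ‖φ ξ‖ₑ) + 2 * L := by
    filter_upwards [eventually_gt_atTop 0] with b hb
    rw [← intervalIntegral.integral_interval_sub_left (hi.intervalIntegrable (a := 0))
      hi.intervalIntegrable, intervalIntegral_ofReal_mul_eq_sub (hpos b hb) hφ,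
      intervalIntegral_ofReal_mul_eq_sub (hneg b hb).symm hφ]
    have tri : ∀ u v w z : ℂ, ‖u - v - (w - z)‖ₑ ≤ ‖u‖ₑ + ‖w‖ₑ + (‖v‖ₑ + ‖z‖ₑ) := by
      intro u v w z
      refine (enorm_sub_le).trans ?_
      refine (add_le_add enorm_sub_le enorm_sub_le).trans (le_of_eq (by ring))
    refine (tri _ _ _ _).trans ?_
    rw [two_mul, add_mul]
    refine add_le_add (add_le_add ?_ ?_) (add_le_add (hLb _) (hLb _)) <;>
    · rw [enorm_mul]
      refine mul_le_mul' (le_of_eq (by simp [enorm_eq_nnnorm])) (hΦ _)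
  refine le_of_tendsto_of_tendsto hconv.enorm ?_ hbd
  simpa using hedge.add_const (2 * L)

/-- The Dirichlet kernel of the interval `[0, t]`. -/
lemma norm_intervalIntegral_exp_le {u : ℝ} (hu : u ≠ 0) (t : ℝ) :
    ‖∫ ξ in (0)..t, Complex.exp (Complex.I * u * ξ)‖ ≤ min |t| (2 / |u|) := by
  have hn : ∀ ξ : ℝ, ‖Complex.exp (Complex.I * u * ξ)‖ = 1 := fun ξ => by
    rw [show Complex.I * u * ξ = ((u * ξ : ℝ) : ℂ) * Complex.I by push_cast; ring,
      Complex.norm_exp_ofReal_mul_I]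
  refine le_min ?_ ?_
  · have := intervalIntegral.norm_integral_le_of_norm_le_const (a := 0) (b := t) (C := 1)
      (f := fun ξ : ℝ => Complex.exp (Complex.I * u * ξ)) fun ξ _ => (hn ξ).le
    simpa using this
  · have hc : Complex.I * (u : ℂ) ≠ 0 := mul_ne_zero Complex.I_ne_zero (by exact_mod_cast hu)
    rw [integral_exp_mul_complex hc, norm_div, norm_mul, Complex.norm_I, one_mul,
      Complex.norm_real, Real.norm_eq_abs]
    gcongr
    refine (norm_sub_le _ _).trans ?_
    rw [hn, hn]; norm_num

lemma continuous_and_integrable_fourierLine (f : SchwartzMap ℝ ℂ) : Continuous (fourierLine f) ∧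
    Integrable (fourierLine f) := by
  have e : fourierLine f = fun ξ => ((1 / Real.sqrt (2 * Real.pi) : ℝ) : ℂ) *
      (FourierTransform.fourier f) (ξ / (2 * Real.pi)) := by
    funext ξ
    rw [fourierLine, SchwartzMap.fourier_coe, Real.fourier_real_eq_integral_exp_smul]
    congr 1
    refine integral_congr_ae (ae_of_all _ fun x => ?_)
    simp only [smul_eq_mul]
    rw [mul_comm]
    congr 2
    push_cast
    field_simp
  rw [e]
  refine ⟨?_, ?_⟩
  · have := (FourierTransform.fourier f).continuous
    fun_prop
  · exact ((FourierTransform.fourier f).integrable.comp_div (by positivity)).const_mul _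

lemma enorm_normalization_le_one : ‖((1 / Real.sqrt (2 * Real.pi) : ℝ) : ℂ)‖ₑ ≤ 1 := by
  rw [← ofReal_norm, Complex.norm_real, Real.norm_eq_abs, abs_of_nonneg (by positivity)]
  rw [ENNReal.ofReal_le_one, div_le_one (by positivity), Real.one_le_sqrt]
  linarith [Real.pi_gt_three]

/-- The partial Fourier integrals over `[0, t]` are dominated by the Dirichlet kernel. -/
lemma enorm_intervalIntegral_fourierLine_le (f : SchwartzMap ℝ ℂ) (x t : ℝ) :
    ‖∫ ξ in (0)..t, fourierLine f ξ * Complex.exp (Complex.I * x * ξ)‖ₑ ≤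
      ∫⁻ y, ‖f y‖ₑ * ENNReal.ofReal (min |t| (2 / |x - y|)) := by
  have e1 : ∫ ξ in (0)..t, fourierLine f ξ * Complex.exp (Complex.I * x * ξ) =
      ((1 / Real.sqrt (2 * Real.pi) : ℝ) : ℂ) *
        ∫ y, f y * ∫ ξ in (0)..t, Complex.exp (Complex.I * (x - y : ℝ) * ξ) := by
    simp_rw [← intervalIntegral.integral_const_mul]
    rw [← intervalIntegral_integral_swap, ← intervalIntegral.integral_const_mul]
    · refine intervalIntegral.integral_congr fun ξ _ => ?_
      simp only [fourierLine]
      rw [mul_assoc, ← integral_mul_const]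
      congr 1
      refine integral_congr_ae (ae_of_all _ fun y => ?_)
      simp only
      rw [mul_assoc, ← Complex.exp_add]
      congr 2
      push_cast; ring
    · have hfin : IsFiniteMeasure (volume.restrict (uIoc 0 t)) := ⟨by simp [uIoc]⟩
      have h0 : Integrable (fun z : ℝ × ℝ => f z.2)
          ((volume.restrict (uIoc 0 t)).prod volume) := f.integrable.comp_snd _
      refine h0.mul_bdd (c := 1) ?_ ?_
      · exact Continuous.aestronglyMeasurable (by fun_prop)
      · refine ae_of_all _ fun z => ?_
        rw [show Complex.I * (x - z.2 : ℝ) * z.1 = (((x - z.2) * z.1 : ℝ) : ℂ) * Complex.I by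
          push_cast; ring, Complex.norm_exp_ofReal_mul_I]
  rw [e1, enorm_mul]
  refine (mul_le_of_le_one_left zero_le enorm_normalization_le_one).trans ?_
  refine (enorm_integral_le_lintegral_enorm _).trans (lintegral_mono_ae ?_)
  have : ∀ᵐ y : ℝ, y ≠ x := by simp [ae_iff]
  filter_upwards [this] with y hy
  rw [enorm_mul]
  gcongr
  rw [← ofReal_norm]
  exact ENNReal.ofReal_le_ofReal (norm_intervalIntegral_exp_le (sub_ne_zero.2 hy.symm) t)

lemma preimage_abs_Ico_subset_dyadicSet (k : ℤ) :
    (fun t : ℝ => |t|) ⁻¹' Ico ((2 : ℝ) ^ k) ((2 : ℝ) ^ (k + 1)) ⊆ dyadicSet k := by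
  intro t ht
  obtain ⟨h1, h2⟩ : (2 : ℝ) ^ k ≤ |t| ∧ |t| < (2 : ℝ) ^ (k + 1) := ht
  rcases le_or_gt 0 t with h0 | h0
  · right
    rw [abs_of_nonneg h0] at h1 h2
    exact ⟨h1, h2⟩
  · left
    rw [abs_of_neg h0] at h1 h2
    exact ⟨by linarith, by linarith⟩

/-- The multiplier is dominated pointwise by the fractional integral of order `α = 1 / r`. -/
lemma exists_enorm_lineMultiplier_le {α : ℝ} (hα : 0 < α) (hα1 : α < 1) :
    ∃ C : ℝ≥0, ∀ (r : ℝ) (_ : 1 / r = α) (lam : ℝ → ℝ)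
    (_ : ∀ b : ℝ, 0 < b → AbsolutelyContinuousOnInterval lam (-b) 0)
    (_ : ∀ b : ℝ, 0 < b → AbsolutelyContinuousOnInterval lam 0 b)
    (_ : Tendsto lam (cocompact ℝ) (𝓝 0)) (f : SchwartzMap ℝ ℂ),
    Integrable (fun ξ => (lam ξ : ℂ) * fourierLine f ξ) ∧
    ∀ x, ‖lineMultiplier (fun ξ => (lam ξ : ℂ)) f x‖ₑ ≤
      C * lineVariation r lam * ∫⁻ y, ‖f y‖ₑ * ENNReal.ofReal (|x - y| ^ (α - 1)) := by
  obtain ⟨C, hC⟩ := exists_lintegral_mul_min_le hα hα1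
  refine ⟨2 * (C * 2), fun r hr lam hneg hpos hlim f => ?_⟩
  have hc := continuous_of_absolutelyContinuousOnInterval hneg hpos
  obtain ⟨M, hM⟩ := exists_norm_le_of_tendsto_cocompact hc hlim
  obtain ⟨hfc, hfi⟩ := continuous_and_integrable_fourierLine f
  have hmul : ∀ φ : ℝ → ℂ, Integrable φ → Integrable fun ξ => (lam ξ : ℂ) * φ ξ := fun φ hφ =>
    hφ.bdd_mul (c := M) (Continuous.aestronglyMeasurable (by fun_prop))
      (ae_of_all _ fun ξ => by simpa using hM ξ)
  refine ⟨hmul _ hfi, fun x => ?_⟩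
  set V := lineVariation r lam with hV
  set φ : ℝ → ℂ := fun ξ => fourierLine f ξ * Complex.exp (Complex.I * x * ξ) with hφ
  have hφc : Continuous φ := by fun_prop
  have hφi : Integrable φ := hfi.mul_bdd (c := 1) (Continuous.aestronglyMeasurable (by fun_prop))
    (ae_of_all _ fun ξ => by
      rw [show Complex.I * x * ξ = ((x * ξ : ℝ) : ℂ) * Complex.I by push_cast; ring,
        Complex.norm_exp_ofReal_mul_I])
  have hdm : Measurable fun t => ‖deriv lam t‖ₑ := (measurable_deriv lam).enorm
  have hdy : ∀ k : ℤ, ENNReal.ofReal ((2 : ℝ) ^ ((k : ℝ) * α)) *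
      ∫⁻ t in (fun t : ℝ => |t|) ⁻¹' Ico ((2 : ℝ) ^ k) ((2 : ℝ) ^ (k + 1)), ‖deriv lam t‖ₑ ≤ V := by
    intro k
    refine le_trans ?_ (le_iSup _ k)
    rw [← hr, mul_one_div]
    refine mul_le_mul_right ((lintegral_mono_set (preimage_abs_Ico_subset_dyadicSet k)).trans
      (le_of_eq ?_)) _
    refine lintegral_congr fun t => ?_
    rw [← ofReal_norm, Real.norm_eq_abs]
  have hkm : Measurable fun z : ℝ × ℝ => ‖deriv lam z.1‖ₑ *
      (‖f z.2‖ₑ * ENNReal.ofReal (min |z.1| (2 / |x - z.2|))) := by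
    have h1 : Measurable fun z : ℝ × ℝ => ‖deriv lam z.1‖ₑ := hdm.comp measurable_fst
    have h2 : Measurable fun z : ℝ × ℝ => ‖f z.2‖ₑ :=
      (f.continuous.measurable.comp measurable_snd).enorm
    fun_prop
  calc ‖lineMultiplier (fun ξ => (lam ξ : ℂ)) f x‖ₑ
      ≤ ‖∫ ξ, (lam ξ : ℂ) * φ ξ‖ₑ := by
        rw [lineMultiplier, fourierLineInv, enorm_mul]
        refine (mul_le_of_le_one_left zero_le enorm_normalization_le_one).trans (le_of_eq ?_)
        simp only [hφ, mul_assoc]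
    _ ≤ 2 * ∫⁻ t, ‖deriv lam t‖ₑ * ‖∫ ξ in (0)..t, φ ξ‖ₑ :=
        enorm_integral_mul_le hneg hpos hlim hφc hφi (hmul _ hφi)
    _ ≤ 2 * ∫⁻ t, ∫⁻ y, ‖deriv lam t‖ₑ * (‖f y‖ₑ * ENNReal.ofReal (min |t| (2 / |x - y|))) := by
        gcongr with t
        rw [lintegral_const_mul' _ _ enorm_ne_top]
        gcongr
        exact enorm_intervalIntegral_fourierLine_le f x t
    _ = 2 * ∫⁻ y, ‖f y‖ₑ * ∫⁻ t, ‖deriv lam t‖ₑ * ENNReal.ofReal (min |t| (2 / |x - y|)) := by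
        rw [lintegral_lintegral_swap hkm.aemeasurable]
        congr 1
        refine lintegral_congr fun y => ?_
        rw [← lintegral_const_mul' _ _ enorm_ne_top]
        refine lintegral_congr fun t => by ring
    _ ≤ 2 * ∫⁻ y, C * V * 2 * (‖f y‖ₑ * ENNReal.ofReal (|x - y| ^ (α - 1))) := by
        refine mul_le_mul_right (lintegral_mono_ae ?_) _
        have : ∀ᵐ y : ℝ, y ≠ x := by simp [ae_iff]
        filter_upwards [this] with y hy
        have hxy : 0 < |x - y| := abs_pos.2 (sub_ne_zero.2 hy.symm)
        have hk := hC ℝ volume (fun t => ‖deriv lam t‖ₑ) (fun t => |t|) (by fun_prop)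
          (fun t => abs_nonneg t) V hdy (2 / |x - y|) (by positivity)
        have h2 : ENNReal.ofReal ((2 / |x - y|) ^ (1 - α)) ≤
            2 * ENNReal.ofReal (|x - y| ^ (α - 1)) := by
          rw [show (2 : ℝ≥0∞) = ENNReal.ofReal 2 by simp, ← ENNReal.ofReal_mul (by norm_num)]
          refine ENNReal.ofReal_le_ofReal ?_
          rw [Real.div_rpow (by norm_num) hxy.le, div_eq_mul_inv, ← Real.rpow_neg hxy.le, neg_sub]
          gcongr
          calc (2 : ℝ) ^ (1 - α) ≤ 2 ^ (1 : ℝ) := by gcongr <;> linarith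
            _ = 2 := Real.rpow_one 2
        calc _ ≤ ‖f y‖ₑ * (C * V * (2 * ENNReal.ofReal (|x - y| ^ (α - 1)))) := by
              gcongr; exact hk.trans (by gcongr)
          _ = _ := by ring
    _ = _ := by
        have h2 : Measurable fun y : ℝ => ‖f y‖ₑ := f.continuous.measurable.enorm
        rw [lintegral_const_mul _ (by fun_prop)]
        push_cast
        ring

/-! ### One-sided multipliers of Fourier series -/

instance : IsProbabilityMeasure unitVolume := ⟨by simp [unitVolume]⟩

/-- The character `x ↦ e^(2πinx)`, as a function on the line. -/
noncomputable def char (n : ℤ) (x : ℝ) : ℂ := Complex.exp (2 * Real.pi * Complex.I * n * x)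

@[fun_prop]
lemma continuous_char (n : ℤ) : Continuous (char n) := by unfold char; fun_prop

lemma norm_char (n : ℤ) (x : ℝ) : ‖char n x‖ = 1 := by
  rw [char, show 2 * Real.pi * Complex.I * n * x = ((2 * Real.pi * n * x : ℝ) : ℂ) * Complex.I by
    push_cast; ring, Complex.norm_exp_ofReal_mul_I]

lemma enorm_char (n : ℤ) (x : ℝ) : ‖char n x‖ₑ = 1 := by
  rw [← ofReal_norm, norm_char, ENNReal.ofReal_one]

lemma char_add (n m : ℤ) (x : ℝ) : char (n + m) x = char n x * char m x := by
  rw [char, char, char, ← Complex.exp_add]; congr 1; push_cast; ring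

lemma char_sub_right (n : ℤ) (x y : ℝ) : char n (x - y) = char n x * char (-n) y := by
  rw [char, char, char, ← Complex.exp_add]; congr 1; push_cast; ring

lemma fourierCoeffOn_eq_integral_char (f : ℝ → ℂ) (n : ℤ) :
    fourierCoeffOn (zero_lt_one (α := ℝ)) f n = ∫ x, char (-n) x * f x ∂unitVolume := by
  rw [fourierCoeffOn_eq_integral, intervalIntegral.integral_of_le zero_le_one,
    integral_Ioc_eq_integral_Ioo, unitVolume]
  simp only [sub_zero, div_one, one_smul]
  refine integral_congr_ae (ae_of_all _ fun x => ?_)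
  simp only [smul_eq_mul, fourier_coe_apply, char]
  congr 2
  simp

lemma integral_char (n : ℤ) : ∫ x, char n x ∂unitVolume = if n = 0 then 1 else 0 := by
  rw [unitVolume, ← integral_Ioc_eq_integral_Ioo, ← intervalIntegral.integral_of_le zero_le_one]
  split_ifs with h
  · simp [h, char]
  · have hc : 2 * Real.pi * Complex.I * (n : ℂ) ≠ 0 := by
      simp [Real.pi_ne_zero, h]
    simp only [char]
    rw [integral_exp_mul_complex hc]
    have : 2 * Real.pi * Complex.I * (n : ℂ) * (1 : ℝ) = n * (2 * Real.pi * Complex.I) := by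
      push_cast; ring
    rw [this, Complex.exp_int_mul_two_pi_mul_I]
    simp

lemma integral_char_mul_char (n k : ℤ) :
    ∫ x, char (-n) x * char k x ∂unitVolume = if k = n then 1 else 0 := by
  simp_rw [← char_add]
  rw [integral_char]
  simp only [neg_add_eq_zero, eq_comm]

/-- The Dirichlet kernel of Fourier series, for the frequencies `0, …, M - 1`. -/
lemma norm_sum_char_le {u : ℝ} (hu : Real.sin (Real.pi * u) ≠ 0) (M : ℕ) :
    ‖∑ j ∈ Finset.range M, char j u‖ ≤ min (M : ℝ) (1 / |Real.sin (Real.pi * u)|) := by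
  refine le_min ?_ ?_
  · refine (norm_sum_le _ _).trans (le_of_eq ?_)
    simp [norm_char]
  · have hpow : ∀ j : ℕ, char j u = char 1 u ^ j := fun j => by
      rw [char, char, ← Complex.exp_nat_mul]; congr 1; push_cast; ring
    have hs : ‖char 1 u - 1‖ = 2 * |Real.sin (Real.pi * u)| := by
      have := Complex.norm_exp_I_mul_ofReal_sub_one (2 * Real.pi * u)
      rw [show 2 * Real.pi * u / 2 = Real.pi * u by ring, norm_mul] at this
      rw [char, show 2 * Real.pi * Complex.I * (1 : ℤ) * u =
        Complex.I * ((2 * Real.pi * u : ℝ) : ℂ) by push_cast; ring, this]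
      simp
    have hne : char 1 u ≠ 1 := fun h => by
      rw [h, sub_self, norm_zero] at hs
      exact hu (abs_eq_zero.1 (by linarith))
    simp_rw [hpow]
    rw [geom_sum_eq hne, norm_div, hs, div_le_div_iff₀ (by positivity) (by positivity)]
    have h2 : ‖char 1 u ^ M - 1‖ ≤ 2 := by
      refine (norm_sub_le _ _).trans ?_
      rw [norm_pow, norm_char, one_pow, norm_one]; norm_num
    calc _ ≤ 2 * |Real.sin (Real.pi * u)| := by gcongr
      _ = _ := (one_mul _).symm

/-- The Riesz kernel `|u| ^ (α - 1)`, `u = x - y`, summed over the translates by `-1`, `0`, `1`. For `x`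
and `y` in `(0, 1)` it dominates the periodic kernel `dist(x - y, ℤ) ^ (α - 1)`. -/
noncomputable def circleKernel (α x y : ℝ) : ℝ≥0∞ :=
  ENNReal.ofReal (|x - y| ^ (α - 1)) + ENNReal.ofReal (|x + 1 - y| ^ (α - 1)) +
    ENNReal.ofReal (|x - 1 - y| ^ (α - 1))

lemma measurable_circleKernel (α : ℝ) : Measurable (Function.uncurry (circleKernel α)) := by
  unfold circleKernel Function.uncurry
  fun_prop

lemma exists_setLIntegral_circleKernel_le {α : ℝ} (hα : 0 < α) (hα1 : α < 1) :
    ∃ A : ℝ≥0, (∀ x, ∀ G, MeasurableSet G →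
        ∫⁻ y in G, circleKernel α x y ∂unitVolume ≤ A * unitVolume G ^ α) ∧
      (∀ y, ∀ G, MeasurableSet G →
        ∫⁻ x in G, circleKernel α x y ∂unitVolume ≤ A * unitVolume G ^ α) := by
  obtain ⟨A, hA⟩ := exists_setLIntegral_riesz_le hα hα1
  have main : ∀ x₁ x₂ x₃ : ℝ, ∀ G, MeasurableSet G →
      ∫⁻ y in G, (ENNReal.ofReal (|x₁ - y| ^ (α - 1)) + ENNReal.ofReal (|x₂ - y| ^ (α - 1)) +
        ENNReal.ofReal (|x₃ - y| ^ (α - 1))) ∂unitVolume ≤ (3 * A : ℝ≥0) * unitVolume G ^ α := by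
    intro x₁ x₂ x₃ G hG
    rw [unitVolume, Measure.restrict_restrict hG, Measure.restrict_apply hG,
      lintegral_add_left (by fun_prop), lintegral_add_left (by fun_prop)]
    have hG' := hG.inter (measurableSet_Ioo (a := (0 : ℝ)) (b := 1))
    refine (add_le_add (add_le_add (hA x₁ _ hG') (hA x₂ _ hG')) (hA x₃ _ hG')).trans (le_of_eq ?_)
    push_cast; ring
  refine ⟨3 * A, fun x G hG => main _ _ _ G hG, fun y G hG => ?_⟩
  refine le_trans (le_of_eq ?_) (main y (y - 1) (y + 1) G hG)
  refine lintegral_congr fun x => ?_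
  rw [circleKernel, abs_sub_comm x y, show x + 1 - y = -(y - 1 - x) by ring, abs_neg,
    show x - 1 - y = -(y + 1 - x) by ring, abs_neg]

lemma le_abs_sin_pi_mul {v : ℝ} (hv : 0 ≤ v) (hv' : v ≤ 1 / 2) : v ≤ Real.sin (Real.pi * v) := by
  have h := Real.mul_le_sin (x := Real.pi * v) (by positivity)
    (by nlinarith [Real.pi_pos])
  have : 2 / Real.pi * (Real.pi * v) = 2 * v := by field_simp
  linarith

/-- The factor `1 / |sin (π (x - y))|` of the Dirichlet kernel, with the power produced by dyadic
summation, is dominated by `circleKernel`. -/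
lemma ofReal_inv_sin_rpow_le {α : ℝ} (hα1 : α < 1) {x y : ℝ} (hx : x ∈ Ioo (0 : ℝ) 1)
    (hy : y ∈ Ioo (0 : ℝ) 1) (hxy : y ≠ x) :
    Real.sin (Real.pi * (x - y)) ≠ 0 ∧
    ENNReal.ofReal ((1 / |Real.sin (Real.pi * (x - y))|) ^ (1 - α)) ≤ circleKernel α x y := by
  have main : ∀ d : ℝ, 0 < d → d ≤ |Real.sin (Real.pi * (x - y))| →
      Real.sin (Real.pi * (x - y)) ≠ 0 ∧
      ENNReal.ofReal ((1 / |Real.sin (Real.pi * (x - y))|) ^ (1 - α)) ≤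
        ENNReal.ofReal (d ^ (α - 1)) := by
    intro d hd hle
    refine ⟨abs_pos.1 (hd.trans_le hle), ENNReal.ofReal_le_ofReal ?_⟩
    calc (1 / |Real.sin (Real.pi * (x - y))|) ^ (1 - α) ≤ (1 / d) ^ (1 - α) := by
          have : 0 ≤ 1 - α := by linarith
          gcongr
      _ = d ^ (α - 1) := by
          rw [one_div, Real.inv_rpow hd.le, ← Real.rpow_neg hd.le, neg_sub]
  have hne : x - y ≠ 0 := sub_ne_zero.2 hxy.symm
  obtain ⟨hx0, hx1⟩ := hx
  obtain ⟨hy0, hy1⟩ := hy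
  rcases le_or_gt |x - y| (1 / 2) with h | h
  · obtain ⟨h1, h2⟩ := main |x - y| (abs_pos.2 hne) (by
      have := le_abs_sin_pi_mul (abs_nonneg (x - y)) h
      rcases abs_cases (x - y) with ⟨e, _⟩ | ⟨e, _⟩
      · rw [e] at this ⊢; exact this.trans (le_abs_self _)
      · rw [e] at this ⊢
        rw [mul_neg, Real.sin_neg] at this
        exact this.trans (neg_le_abs _))
    exact ⟨h1, h2.trans (le_add_right (le_add_right le_rfl))⟩
  · rcases abs_cases (x - y) with ⟨e, _⟩ | ⟨e, _⟩
    · rw [e] at h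
      obtain ⟨h1, h2⟩ := main (1 - (x - y)) (by linarith) (by
        have := le_abs_sin_pi_mul (v := 1 - (x - y)) (by linarith) (by linarith)
        rw [mul_sub, mul_one, Real.sin_pi_sub] at this
        exact this.trans (le_abs_self _))
      refine ⟨h1, h2.trans (le_add_left (le_of_eq ?_))⟩
      rw [show x - 1 - y = -(1 - (x - y)) by ring, abs_neg, abs_of_pos (by linarith)]
    · rw [e] at h
      obtain ⟨h1, h2⟩ := main (1 + (x - y)) (by linarith) (by
        have := le_abs_sin_pi_mul (v := 1 + (x - y)) (by linarith) (by linarith)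
        rw [mul_add, mul_one, add_comm Real.pi, Real.sin_add_pi] at this
        exact this.trans (neg_le_abs _))
      refine ⟨h1, h2.trans (le_add_right (le_add_left (le_of_eq ?_)))⟩
      rw [show x + 1 - y = 1 + (x - y) by ring, abs_of_pos (by linarith)]

/-- The fractional integral of `|f|` on `(0, 1)` with kernel `circleKernel`. -/
noncomputable def circlePotential (α : ℝ) (f : ℝ → ℂ) (x : ℝ) : ℝ≥0∞ :=
  ∫⁻ y, ‖f y‖ₑ * circleKernel α x y ∂unitVolume

lemma aemeasurable_circlePotential (α : ℝ) {f : ℝ → ℂ} (hf : AEStronglyMeasurable f unitVolume) :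
    AEMeasurable (circlePotential α f) unitVolume := by
  have h : AEMeasurable (Function.uncurry fun x y => ‖f y‖ₑ * circleKernel α x y)
      (unitVolume.prod unitVolume) :=
    hf.enorm.comp_snd.mul (measurable_circleKernel α).aemeasurable
  exact h.lintegral_prod_right'

lemma exists_eLpNorm_circlePotential_le {p q α : ℝ} (hp : 1 < p) (hpq : p < q)
    (hα : α = 1 / p - 1 / q) (hα0 : 0 < α) (hα1 : α < 1) :
    ∃ C : ℝ≥0, ∀ f : ℝ → ℂ, MemLp f (ENNReal.ofReal p) unitVolume →
      eLpNorm (circlePotential α f) (ENNReal.ofReal q) unitVolume ≤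
        C * eLpNorm f (ENNReal.ofReal p) unitVolume := by
  obtain ⟨A, hA1, hA2⟩ := exists_setLIntegral_circleKernel_le hα0 hα1
  obtain ⟨C, hC⟩ := exists_fractional_integral_bound hp hpq hα
  refine ⟨C * A, fun f hf => ?_⟩
  push_cast
  exact hC ℝ unitVolume (circleKernel α) (measurable_circleKernel α) A hA1 hA2 ℂ f hf

/-- Partial Fourier sums of `f` along frequencies `N 0, N 1, …` whose Dirichlet kernels have the
usual bound. -/
lemma enorm_sum_char_integral_le {f : ℝ → ℂ} (hf : Integrable f unitVolume) {N : ℕ → ℤ}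
    (hN : ∀ (u : ℝ) (M : ℕ), Real.sin (Real.pi * u) ≠ 0 →
      ‖∑ j ∈ Finset.range M, char (N j) u‖ ≤ min (M : ℝ) (1 / |Real.sin (Real.pi * u)|))
    (M : ℕ) {x : ℝ} (hx : x ∈ Ioo (0 : ℝ) 1) :
    ‖∑ j ∈ Finset.range M, (∫ y, char (-N j) y * f y ∂unitVolume) * char (N j) x‖ₑ ≤
      ∫⁻ y, ‖f y‖ₑ * ENNReal.ofReal (min (M : ℝ) (1 / |Real.sin (Real.pi * (x - y))|))
        ∂unitVolume := by
  have hi : ∀ n : ℤ, Integrable (fun y => char (-n) y * f y * char n x) unitVolume := fun n =>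
    (hf.bdd_mul (c := 1) (continuous_char _).aestronglyMeasurable
      (ae_of_all _ fun y => (norm_char _ _).le)).mul_const _
  have e : ∑ j ∈ Finset.range M, (∫ y, char (-N j) y * f y ∂unitVolume) * char (N j) x =
      ∫ y, f y * ∑ j ∈ Finset.range M, char (N j) (x - y) ∂unitVolume := by
    simp_rw [← integral_mul_const]
    rw [← integral_finsetSum _ fun j _ => hi (N j)]
    refine integral_congr_ae (ae_of_all _ fun y => ?_)
    simp only [Finset.mul_sum, char_sub_right]
    refine Finset.sum_congr rfl fun j _ => by ring
  rw [e]
  refine (enorm_integral_le_lintegral_enorm _).trans (lintegral_mono_ae ?_)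
  have h1 : ∀ᵐ y ∂unitVolume, y ≠ x := ae_restrict_of_ae (by simp [ae_iff])
  filter_upwards [h1, ae_restrict_mem measurableSet_Ioo] with y hy hy01
  rw [enorm_mul]
  gcongr
  rw [← ofReal_norm]
  exact ENNReal.ofReal_le_ofReal
    (hN _ _ (ofReal_inv_sin_rpow_le (α := 0) zero_lt_one hx hy01 hy).1)

/-- Existence and bound of the multiplier image for a symbol that equals `l j` at the frequency `N j`
and vanishes at all other frequencies. Summation by parts defines the image as
`∑ (l m - l (m + 1)) S_m f`, where `S_m f` is the partial Fourier sum over `N 0, …, N m`; the series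
converges absolutely almost everywhere and in `L_1`, as it is dominated by `B * circlePotential α f`.
The hypothesis `hlB` is the outcome of dyadic summation of the differences of `l`. -/
lemma exists_oneSided_multiplier {p q α : ℝ} (hp : 1 ≤ p) (hq : 1 ≤ q) (hα1 : α < 1)
    {f : ℝ → ℂ} (hf : MemLp f (ENNReal.ofReal p) unitVolume)
    (hI : eLpNorm (circlePotential α f) (ENNReal.ofReal q) unitVolume ≠ ∞)
    {l : ℕ → ℝ} (hl : Tendsto l atTop (𝓝 0)) {B : ℝ≥0∞} (hB : B ≠ ∞)
    (hlB : ∀ D : ℝ, 0 < D → ∑' m : ℕ, ‖l m - l (m + 1)‖ₑ *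
      ENNReal.ofReal (min ((m + 1 : ℕ) : ℝ) D) ≤ B * ENNReal.ofReal (D ^ (1 - α)))
    {N : ℕ → ℤ} (hNinj : Function.Injective N)
    (hN : ∀ (u : ℝ) (M : ℕ), Real.sin (Real.pi * u) ≠ 0 →
      ‖∑ j ∈ Finset.range M, char (N j) u‖ ≤ min (M : ℝ) (1 / |Real.sin (Real.pi * u)|)) :
    ∃ g : ℝ → ℂ, MemLp g (ENNReal.ofReal q) unitVolume ∧
      (∀ j, ∫ x, char (-N j) x * g x ∂unitVolume =
        l j * ∫ x, char (-N j) x * f x ∂unitVolume) ∧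
      (∀ n, n ∉ range N → ∫ x, char (-n) x * g x ∂unitVolume = 0) ∧
      eLpNorm g (ENNReal.ofReal q) unitVolume ≤
        B * eLpNorm (circlePotential α f) (ENNReal.ofReal q) unitVolume := by
  have hfi : Integrable f unitVolume := hf.integrable (by simpa using hp)
  set a : ℕ → ℂ := fun j => ∫ y, char (-N j) y * f y ∂unitVolume with ha
  set S : ℕ → ℝ → ℂ := fun m x => ∑ j ∈ Finset.range (m + 1), a j * char (N j) x with hS
  have hSc : ∀ m, Continuous (S m) := fun m => by fun_prop
  set c : ℕ → ℝ := fun m => l m - l (m + 1) with hc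
  set I := circlePotential α f with hIdef
  have hdom : ∀ᵐ x ∂unitVolume, ∑' m, ‖(c m : ℂ) * S m x‖ₑ ≤ B * I x := by
    filter_upwards [ae_restrict_mem measurableSet_Ioo] with x hx
    calc ∑' m, ‖(c m : ℂ) * S m x‖ₑ
        ≤ ∑' m, ∫⁻ y, ‖c m‖ₑ * (‖f y‖ₑ * ENNReal.ofReal
            (min ((m + 1 : ℕ) : ℝ) (1 / |Real.sin (Real.pi * (x - y))|))) ∂unitVolume := by
          refine ENNReal.tsum_le_tsum fun m => ?_
          rw [enorm_mul, lintegral_const_mul' _ _ enorm_ne_top]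
          refine mul_le_mul' (le_of_eq ?_) (enorm_sum_char_integral_le hfi hN (m + 1) hx)
          simp [enorm_eq_nnnorm]
      _ = ∫⁻ y, ∑' m, ‖c m‖ₑ * (‖f y‖ₑ * ENNReal.ofReal
            (min ((m + 1 : ℕ) : ℝ) (1 / |Real.sin (Real.pi * (x - y))|))) ∂unitVolume := by
          rw [lintegral_tsum fun m => ?_]
          have := hf.1.enorm
          fun_prop
      _ ≤ ∫⁻ y, B * (‖f y‖ₑ * circleKernel α x y) ∂unitVolume := by
          refine lintegral_mono_ae ?_
          have h1 : ∀ᵐ y ∂unitVolume, y ≠ x := ae_restrict_of_ae (by simp [ae_iff])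
          filter_upwards [h1, ae_restrict_mem measurableSet_Ioo] with y hy hy01
          obtain ⟨hs, hk⟩ := ofReal_inv_sin_rpow_le hα1 hx hy01 hy
          calc _ = ‖f y‖ₑ * ∑' m : ℕ, ‖c m‖ₑ * ENNReal.ofReal
                (min ((m + 1 : ℕ) : ℝ) (1 / |Real.sin (Real.pi * (x - y))|)) := by
                rw [← ENNReal.tsum_mul_left]
                exact tsum_congr fun m => by ring
            _ ≤ ‖f y‖ₑ * (B * circleKernel α x y) := by
                gcongr
                exact (hlB _ (by positivity)).trans (by gcongr)
            _ = _ := by ring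
      _ = B * I x := by rw [lintegral_const_mul' _ _ hB]; rfl
  have hIm : AEMeasurable I unitVolume := aemeasurable_circlePotential α hf.1
  have hIint : ∫⁻ x, I x ∂unitVolume ≠ ∞ := by
    have h1 : eLpNorm I 1 unitVolume ≤ eLpNorm I (ENNReal.ofReal q) unitVolume :=
      eLpNorm_le_eLpNorm_of_exponent_le (by simpa using hq) hIm.aestronglyMeasurable
    rw [eLpNorm_one_eq_lintegral_enorm] at h1
    exact ne_top_of_le_ne_top hI (by simpa using h1)
  have hIfin : ∀ᵐ x ∂unitVolume, I x < ∞ := ae_lt_top' hIm hIint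
  have hsum : ∀ᵐ x ∂unitVolume, Summable fun m => (c m : ℂ) * S m x := by
    filter_upwards [hdom, hIfin] with x h1 h2
    have : ∑' m, ‖(c m : ℂ) * S m x‖ₑ ≠ ∞ :=
      ne_top_of_le_ne_top (ENNReal.mul_ne_top hB h2.ne) h1
    exact Summable.of_enorm this
  set g : ℝ → ℂ := fun x => ∑' m, (c m : ℂ) * S m x with hg
  have hgm : AEStronglyMeasurable g unitVolume := by
    refine aestronglyMeasurable_of_tendsto_ae (u := atTop)
      (f := fun M x => ∑ m ∈ Finset.range M, (c m : ℂ) * S m x) (fun M => ?_) ?_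
    · exact Continuous.aestronglyMeasurable (by fun_prop)
    · filter_upwards [hsum] with x hx
      exact hx.hasSum.tendsto_sum_nat
  have hgI : ∀ᵐ x ∂unitVolume, ‖g x‖ₑ ≤ B * I x := by
    filter_upwards [hdom] with x hx
    exact enorm_tsum_le_tsum_enorm.trans hx
  have hgn : eLpNorm g (ENNReal.ofReal q) unitVolume ≤
      B * eLpNorm I (ENNReal.ofReal q) unitVolume := by
    lift B to ℝ≥0 using hB
    exact eLpNorm_le_nnreal_smul_eLpNorm_of_ae_le_mul' hgI _
  have hcs : Summable c := by
    have h1 := hlB 1 one_pos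
    have h2 : ∑' m, ‖c m‖ₑ ≠ ∞ := by
      refine ne_top_of_le_ne_top (ENNReal.mul_ne_top hB ENNReal.ofReal_ne_top)
        (le_trans (le_of_eq (tsum_congr fun m => ?_)) h1)
      rw [min_eq_right (by push_cast; linarith [(Nat.cast_nonneg m : (0 : ℝ) ≤ m)])]
      simp [hc]
    exact Summable.of_enorm h2
  have hcoef : ∀ n, ∫ x, char (-n) x * g x ∂unitVolume =
      ∑' m, (c m : ℂ) * ∑ j ∈ Finset.range (m + 1), a j * if N j = n then 1 else 0 := by
    intro n
    have e1 : ∀ x, char (-n) x * g x = ∑' m, char (-n) x * ((c m : ℂ) * S m x) := fun x =>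
      tsum_mul_left.symm
    simp_rw [e1]
    rw [integral_tsum]
    · refine tsum_congr fun m => ?_
      calc ∫ x, char (-n) x * ((c m : ℂ) * S m x) ∂unitVolume
          = ∫ x, (c m : ℂ) * ∑ j ∈ Finset.range (m + 1), a j * (char (-n) x * char (N j) x)
              ∂unitVolume := by
            refine integral_congr_ae (ae_of_all _ fun x => ?_)
            simp only [hS, Finset.mul_sum]
            exact Finset.sum_congr rfl fun j _ => by ring
        _ = _ := by
            rw [integral_const_mul, integral_finsetSum]
            · simp_rw [integral_const_mul, integral_char_mul_char]
            · intro j _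
              refine Integrable.const_mul ?_ _
              simp_rw [← char_add]
              exact Integrable.of_bound (continuous_char _).aestronglyMeasurable 1
                (ae_of_all _ fun x => (norm_char _ _).le)
    · intro m
      exact Continuous.aestronglyMeasurable (by fun_prop)
    · rw [← lintegral_tsum]
      · simp_rw [enorm_mul, enorm_char, one_mul, ← enorm_mul]
        refine ne_top_of_le_ne_top ?_ (lintegral_mono_ae hdom)
        rw [lintegral_const_mul' _ _ hB]
        exact ENNReal.mul_ne_top hB hIint
      · intro m
        exact Continuous.aemeasurable (by fun_prop)
  refine ⟨g, ⟨hgm, lt_of_le_of_lt hgn (ENNReal.mul_lt_top hB.lt_top hI.lt_top)⟩, ?_, ?_, hgn⟩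
  · intro i
    rw [hcoef]
    have e2 : ∀ m, (c m : ℂ) * ∑ j ∈ Finset.range (m + 1), a j * (if N j = N i then 1 else 0) =
        ((if i ≤ m then c m else 0 : ℝ) : ℂ) * a i := by
      intro m
      simp only [hNinj.eq_iff, mul_ite, mul_one, mul_zero, Finset.sum_ite_eq', Finset.mem_range,
        Nat.lt_succ_iff]
      split_ifs <;> simp
    simp_rw [e2]
    rw [tsum_mul_right, ← Complex.ofReal_tsum]
    congr 2
    have hs : Summable fun m => if i ≤ m then c m else 0 := by
      have := hcs.indicator {m | i ≤ m}
      refine this.congr fun m => ?_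
      simp [indicator_apply]
    refine HasSum.tsum_eq (hs.hasSum_iff_tendsto_nat.2 ?_)
    -- The sum of `l m - l (m + 1)` over `m ≥ i` telescopes to `l i`, as `l` tends to `0`.
    have hpart : ∀ M, i ≤ M → ∑ m ∈ Finset.range M, (if i ≤ m then c m else 0) = l i - l M := by
      intro M hM
      induction M, hM using Nat.le_induction with
      | base =>
        rw [sub_self]
        exact Finset.sum_eq_zero fun m hm => if_neg (by simpa using hm)
      | succ M hM ih => rw [Finset.sum_range_succ, ih, if_pos hM, hc]; ring
    have : Tendsto (fun M => l i - l M) atTop (𝓝 (l i)) := by simpa using hl.const_sub (l i)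
    refine this.congr' ?_
    filter_upwards [eventually_ge_atTop i] with M hM
    exact (hpart M hM).symm
  · intro n hn
    rw [hcoef]
    have : ∀ j, N j ≠ n := fun j h => hn ⟨j, h⟩
    simp [this]

/-! ### Norm bounds for the multipliers -/

/-- The variation of `lam` between `m - 1` and `m` and between `-m + 1` and `-m`: the `m`-th term of the
sums in `seriesVariation`. -/
noncomputable def jump (lam : ℤ → ℝ) (m : ℕ) : ℝ≥0∞ :=
  ‖lam (-(m : ℤ)) - lam (-(m : ℤ) + 1)‖ₑ + ‖lam (m : ℤ) - lam ((m : ℤ) - 1)‖ₑ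

lemma exists_tsum_jump_mul_min_le {α : ℝ} (hα : 0 < α) (hα1 : α < 1) :
    ∃ C : ℝ≥0, ∀ (r : ℝ) (_ : 1 / r = α) (lam : ℤ → ℝ) (D : ℝ) (_ : 0 < D),
      ∑' m : ℕ, jump lam m * ENNReal.ofReal (min (m : ℝ) D) ≤
        C * seriesVariation r lam * ENNReal.ofReal (D ^ (1 - α)) := by
  obtain ⟨C, hC⟩ := exists_lintegral_mul_min_le hα hα1
  refine ⟨C, fun r hr lam D hD => ?_⟩
  rw [← lintegral_count]
  refine hC ℕ Measure.count (jump lam) (fun m => (m : ℝ)) measurable_from_top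
    (fun m => Nat.cast_nonneg m) _ (fun k => ?_) D hD
  rcases lt_or_ge k 0 with hk | hk
  · have : (fun m : ℕ => (m : ℝ)) ⁻¹' Ico ((2 : ℝ) ^ k) ((2 : ℝ) ^ (k + 1)) = ∅ := by
      refine eq_empty_iff_forall_notMem.2 fun m hm => ?_
      obtain ⟨h1, h2⟩ : (2 : ℝ) ^ k ≤ m ∧ (m : ℝ) < (2 : ℝ) ^ (k + 1) := hm
      have h3 : (2 : ℝ) ^ (k + 1) ≤ 1 := zpow_le_one_of_nonpos₀ one_le_two (by omega)
      have h4 : (0 : ℝ) < m := (zpow_pos two_pos k).trans_le h1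
      have h5 : m < 1 := by exact_mod_cast h2.trans_le h3
      have h6 : 0 < m := by exact_mod_cast h4
      omega
    rw [this]; simp
  · lift k to ℕ using hk
    have hsub : (fun m : ℕ => (m : ℝ)) ⁻¹' Ico ((2 : ℝ) ^ (k : ℤ)) ((2 : ℝ) ^ ((k : ℤ) + 1)) ⊆
        ↑(Finset.Ico (2 ^ k) (2 ^ (k + 1))) := by
      intro m hm
      obtain ⟨h1, h2⟩ : (2 : ℝ) ^ (k : ℤ) ≤ m ∧ (m : ℝ) < (2 : ℝ) ^ ((k : ℤ) + 1) := hm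
      rw [Finset.coe_Ico]
      exact ⟨by exact_mod_cast h1, by exact_mod_cast h2⟩
    refine le_trans ?_ (le_iSup _ k)
    rw [ENNReal.ofReal_mul (by positivity), Int.cast_natCast, ← hr, mul_one_div]
    gcongr
    refine (lintegral_mono_set hsub).trans (le_of_eq ?_)
    rw [lintegral_finset]
    refine Eq.trans ?_ (ENNReal.ofReal_sum_of_nonneg fun m _ => by positivity).symm
    -- The sums in `seriesVariation` run over integers.
    refine Finset.sum_nbij (fun m : ℕ => (m : ℤ)) (fun m hm => ?_)
      (fun _ _ _ _ h => Nat.cast_injective h) (fun z hz => ?_) (fun m _ => ?_)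
    · rw [Finset.mem_Ico] at hm ⊢
      exact ⟨by exact_mod_cast hm.1, by exact_mod_cast hm.2⟩
    · rw [Finset.mem_coe, Finset.mem_Ico] at hz
      lift z to ℕ using (pow_pos two_pos k).le.trans hz.1
      refine ⟨z, ?_, rfl⟩
      rw [Finset.mem_coe, Finset.mem_Ico]
      exact ⟨by exact_mod_cast hz.1, by exact_mod_cast hz.2⟩
    rw [Measure.count_singleton, mul_one, ENNReal.ofReal_add (abs_nonneg _) (abs_nonneg _), jump,
      ← Real.norm_eq_abs, ← Real.norm_eq_abs, ofReal_norm, ofReal_norm]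

/-- Transfer of the bound for `jump` to a one-sided sequence of differences with index shifted by
`d`. -/
lemma tsum_mul_min_le_of_le_jump (lam : ℤ → ℝ) {w : ℕ → ℝ≥0∞} {d : ℕ} (hd : 1 ≤ d)
    (hw : ∀ m, w m ≤ jump lam (m + d)) (D : ℝ) :
    ∑' m : ℕ, w m * ENNReal.ofReal (min ((m + 1 : ℕ) : ℝ) D) ≤
      ∑' m : ℕ, jump lam m * ENNReal.ofReal (min (m : ℝ) D) := by
  calc _ ≤ ∑' m : ℕ, jump lam (m + d) * ENNReal.ofReal (min ((m + d : ℕ) : ℝ) D) := by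
        refine ENNReal.tsum_le_tsum fun m => ?_
        gcongr
        exact hw m
    _ ≤ _ := ENNReal.tsum_comp_le_tsum_of_injective (add_left_injective d)
        fun m => jump lam m * ENNReal.ofReal (min (m : ℝ) D)

theorem exists_lineMultiplierNorm_le {p q r : ℝ} (hp : 1 < p) (hpq : p < q)
    (hr : 1 / r = 1 / p - 1 / q) (hα0 : 0 < 1 / r) (hα1 : 1 / r < 1) :
    ∃ C : ℝ≥0, ∀ lam : ℝ → ℝ,
      (∀ b : ℝ, 0 < b → AbsolutelyContinuousOnInterval lam (-b) 0) →
      (∀ b : ℝ, 0 < b → AbsolutelyContinuousOnInterval lam 0 b) →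
      Tendsto lam (cocompact ℝ) (𝓝 0) →
      lineMultiplierNorm p q (fun ξ => (lam ξ : ℂ)) ≤ C * lineVariation r lam := by
  obtain ⟨C₁, hC₁⟩ := exists_enorm_lineMultiplier_le hα0 hα1
  obtain ⟨C₂, hC₂⟩ := exists_fractional_integral_bound hp hpq hr
  obtain ⟨A, hA⟩ := exists_setLIntegral_riesz_le hα0 hα1
  -- The constant is made positive for the case of infinite variation: `0 * ∞ = 0`.
  refine ⟨C₁ * (C₂ * A) + 1, fun lam hneg hpos hlim => ?_⟩
  by_cases hV : lineVariation r lam = ∞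
  · rw [hV, ENNReal.mul_top (by simp)]; exact le_top
  refine sInf_le fun f => ?_
  obtain ⟨hi, hb⟩ := hC₁ r rfl lam hneg hpos hlim f
  refine ⟨hi, ?_⟩
  have hlift : (C₁ * lineVariation r lam) = ((C₁ * (lineVariation r lam).toNNReal : ℝ≥0) : ℝ≥0∞) := by
    rw [ENNReal.coe_mul, ENNReal.coe_toNNReal hV]
  have h1 : eLpNorm (lineMultiplier (fun ξ => (lam ξ : ℂ)) f) (ENNReal.ofReal q) volume ≤
      (C₁ * lineVariation r lam) * eLpNorm (fun x => ∫⁻ y, ‖f y‖ₑ *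
        ENNReal.ofReal (|x - y| ^ (1 / r - 1))) (ENNReal.ofReal q) volume := by
    rw [hlift] at hb ⊢
    exact eLpNorm_le_nnreal_smul_eLpNorm_of_ae_le_mul' (ae_of_all _ hb) _
  have h2 := hC₂ ℝ volume (fun x y => ENNReal.ofReal (|x - y| ^ (1 / r - 1)))
    (by unfold Function.uncurry; fun_prop) A hA
    (fun y G hG => by simp_rw [abs_sub_comm _ y]; exact hA y G hG) ℂ f (f.memLp _ _)
  calc _ ≤ _ := h1
    _ ≤ (C₁ * lineVariation r lam) * (C₂ * A * eLpNorm f (ENNReal.ofReal p) volume) := by gcongr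
    _ = ((C₁ * (C₂ * A) : ℝ≥0) : ℝ≥0∞) * lineVariation r lam *
        eLpNorm f (ENNReal.ofReal p) volume := by push_cast; ring
    _ ≤ _ := by
        gcongr
        exact le_add_of_nonneg_right zero_le_one

theorem exists_seriesMultiplierNorm_le {p q r : ℝ} (hp : 1 < p) (hpq : p < q)
    (hr : 1 / r = 1 / p - 1 / q) (hα0 : 0 < 1 / r) (hα1 : 1 / r < 1) :
    ∃ C : ℝ≥0, ∀ lam : ℤ → ℝ, Tendsto lam cofinite (𝓝 0) →
      seriesMultiplierNorm p q (fun k => (lam k : ℂ)) ≤ C * seriesVariation r lam := by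
  obtain ⟨C₁, hC₁⟩ := exists_tsum_jump_mul_min_le hα0 hα1
  obtain ⟨C₂, hC₂⟩ := exists_eLpNorm_circlePotential_le hp hpq hr hα0 hα1
  -- The constant is made positive for the case of infinite variation: `0 * ∞ = 0`.
  refine ⟨2 * C₁ * C₂ + 1, fun lam hlim => ?_⟩
  by_cases hV : seriesVariation r lam = ∞
  · rw [hV, ENNReal.mul_top (by simp)]; exact le_top
  refine sInf_le fun f hf => ?_
  have hI := hC₂ f hf
  have hItop : eLpNorm (circlePotential (1 / r) f) (ENNReal.ofReal q) unitVolume ≠ ∞ :=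
    ne_top_of_le_ne_top (ENNReal.mul_ne_top ENNReal.coe_ne_top hf.2.ne) hI
  have hB : C₁ * seriesVariation r lam ≠ ∞ := ENNReal.mul_ne_top ENNReal.coe_ne_top hV
  have hlim' : ∀ N : ℕ → ℤ, Function.Injective N → Tendsto (fun j => lam (N j)) atTop (𝓝 0) :=
    fun N hN => by
      rw [← Nat.cofinite_eq_atTop]
      exact hlim.comp hN.tendsto_cofinite
  -- The frequencies `j` and `-1 - j`, `j ≥ 0`, cover the integers once.
  have hinj₁ : Function.Injective fun j : ℕ => (j : ℤ) := Nat.cast_injective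
  have hinj₂ : Function.Injective fun j : ℕ => -1 - (j : ℤ) := fun i j h => by
    simpa using h
  obtain ⟨g₁, hg₁, hc₁, hz₁, hn₁⟩ := exists_oneSided_multiplier hp.le (hp.trans hpq).le hα1 hf hItop
    (hlim' _ hinj₁) hB (fun D hD => (tsum_mul_min_le_of_le_jump lam (d := 1) le_rfl (fun m => by
      refine le_add_left (le_of_eq ?_)
      rw [enorm_sub_rev]
      push_cast
      rw [add_sub_cancel_right]) D).trans (hC₁ r rfl lam D hD))
    hinj₁ (fun u M hu => norm_sum_char_le hu M)
  obtain ⟨g₂, hg₂, hc₂, hz₂, hn₂⟩ := exists_oneSided_multiplier hp.le (hp.trans hpq).le hα1 hf hItop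
    (hlim' _ hinj₂) hB (fun D hD => (tsum_mul_min_le_of_le_jump lam (d := 2) one_le_two (fun m => by
      refine le_add_right (le_of_eq ?_)
      rw [enorm_sub_rev]
      push_cast
      ring_nf) D).trans (hC₁ r rfl lam D hD))
    hinj₂ (fun u M hu => by
      have hu' : Real.sin (Real.pi * -u) ≠ 0 := by rwa [mul_neg, Real.sin_neg, neg_ne_zero]
      have h := norm_sum_char_le hu' M
      rw [mul_neg, Real.sin_neg, abs_neg] at h
      refine le_trans (le_of_eq ?_) h
      have e : ∀ j : ℕ, char (-1 - (j : ℤ)) u = char (-1) u * char j (-u) := fun j => by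
        rw [char, char, char, ← Complex.exp_add]; congr 1; push_cast; ring
      simp_rw [e]
      rw [← Finset.mul_sum, norm_mul, norm_char, one_mul])
  have hq1 : 1 ≤ ENNReal.ofReal q := by simpa using (hp.trans hpq).le
  refine ⟨g₁ + g₂, hg₁.add hg₂, fun k => ?_, ?_⟩
  · have hi : ∀ g : ℝ → ℂ, MemLp g (ENNReal.ofReal q) unitVolume →
        Integrable (fun x => char (-k) x * g x) unitVolume := fun g hg =>
      (hg.integrable hq1).bdd_mul (c := 1) (continuous_char _).aestronglyMeasurable
        (ae_of_all _ fun y => (norm_char _ _).le)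
    rw [fourierCoeffOn_eq_integral_char, fourierCoeffOn_eq_integral_char]
    simp only [Pi.add_apply, mul_add]
    rw [integral_add (hi _ hg₁) (hi _ hg₂)]
    rcases le_or_gt 0 k with hk | hk
    · obtain ⟨j, rfl⟩ := Int.eq_ofNat_of_zero_le hk
      rw [hc₁ j, hz₂ j (by rintro ⟨i, hi⟩; simp only at hi; omega), add_zero]
    · obtain ⟨j, rfl⟩ : ∃ j : ℕ, k = -1 - (j : ℤ) := ⟨(-1 - k).toNat, by omega⟩
      rw [hc₂ j, hz₁ _ (by rintro ⟨i, hi⟩; simp only at hi; omega), zero_add]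
  · calc eLpNorm (g₁ + g₂) (ENNReal.ofReal q) unitVolume
        ≤ eLpNorm g₁ (ENNReal.ofReal q) unitVolume + eLpNorm g₂ (ENNReal.ofReal q) unitVolume :=
          eLpNorm_add_le hg₁.1 hg₂.1 hq1
      _ ≤ C₁ * seriesVariation r lam * (C₂ * eLpNorm f (ENNReal.ofReal p) unitVolume) +
          C₁ * seriesVariation r lam * (C₂ * eLpNorm f (ENNReal.ofReal p) unitVolume) :=
          add_le_add (hn₁.trans (by gcongr)) (hn₂.trans (by gcongr))
      _ = ((2 * C₁ * C₂ : ℝ≥0) : ℝ≥0∞) * seriesVariation r lam *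
          eLpNorm f (ENNReal.ofReal p) unitVolume := by push_cast; ring
      _ ≤ _ := by
          gcongr
          exact le_add_of_nonneg_right zero_le_one

end LizorkinMultiplier

theorem theorem1p2 (p q r : ℝ) (hp : 1 < p) (hpq : p < q) (hr : 1 / r = 1 / p - 1 / q) :
    (∃ C : ℝ≥0, ∀ lam : ℝ → ℝ,
      (∀ b : ℝ, 0 < b → AbsolutelyContinuousOnInterval lam (-b) 0) →
      (∀ b : ℝ, 0 < b → AbsolutelyContinuousOnInterval lam 0 b) →
      Tendsto lam (cocompact ℝ) (𝓝 0) →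
      LizorkinMultiplier.lineMultiplierNorm p q (fun ξ => (lam ξ : ℂ))
        ≤ C * LizorkinMultiplier.lineVariation r lam) ∧
    (∃ C : ℝ≥0, ∀ lam : ℤ → ℝ,
      Tendsto lam cofinite (𝓝 0) →
      LizorkinMultiplier.seriesMultiplierNorm p q (fun k => (lam k : ℂ))
        ≤ C * LizorkinMultiplier.seriesVariation r lam) := by
  have hp0 : 0 < p := by linarith
  have hα0 : 0 < 1 / r := by
    rw [hr, sub_pos]; exact one_div_lt_one_div_of_lt hp0 hpq
  have hα1 : 1 / r < 1 := by
    have h1 : 1 / p < 1 := by rw [div_lt_one hp0]; exact hp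
    have h2 : 0 < 1 / q := one_div_pos.2 (hp0.trans hpq)
    linarith
  exact ⟨LizorkinMultiplier.exists_lineMultiplierNorm_le hp hpq hr hα0 hα1,
    LizorkinMultiplier.exists_seriesMultiplierNorm_le hp hpq hr hα0 hα1⟩
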